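/- Let $v=(v_1,v_2)^\top$ with $v_1,v_2\in L^2(\mathbb T)$ complex-valued, $\mathbb T=\mathbb R/\mathbb Z$, regarded as $1$-periodic functions on $\mathbb R$. Put $$J=\begin{pmatrix}1&0\\0&-\mathbb 1_2\end{pmatrix},\qquad V=\begin{pmatrix}0&v^*\\ v&0\end{pmatrix},$$ and let $\mathcal L=iJ\frac{d}{dx}+V$ be the operator in $L^2(\mathbb R,\mathbb C^3)$ with domain $\{u\in L^2(\mathbb R,\mathbb C^3): u \text{ locally absolutely continuous},\ iJu'+Vu\in L^2(\mathbb R,\mathbb C^3)\}$. For every $\lambda\in\mathbb C$ there is a unique locally absolutely continuous $3\times3$ matrix-valued solution $y(x,\lambda)$, $x\in\mathbb R$, of $iJy'+Vy=\lambda y$ (a.e.), $y(0,\lambda)=\mathbb 1_3$. Let $\psi(\lambda)=y(1,\lambda)$, $D(\tau,\lambda)=\det(\psi(\lambda)-\tau\mathbb 1_3)$, $T(\lambda)=\operatorname{Tr}\psi(\lambda)$, $\widetilde T(\lambda)=\overline{T(\overline\lambda)}$, and let the multipliers $\tau_1(\lambda),\tau_2(\lambda),\tau_3(\lambda)$ be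 the eigenvalues of $\psi(\lambda)$ counted with algebraic multiplicity. Put $\tau_1^o(\lambda)=\tau_2^o(\lambda)=e^{i\lambda}$ and $\tau_3^o(\lambda)=e^{-i\lambda}$ (the multipliers for $v=0$). For $k\in\{1,2,3\}$ let $\mathfrak S_k$ be the set of $\lambda\in\mathbb R$ such that $|\tau_j(\lambda)|=1$ for exactly $k$ of the indices $j\in\{1,2,3\}$. Then: (i) The multipliers can be labelled, for each $\lambda\in\mathbb C$, so that for every $\delta\in(0,\tfrac12)$ and every $j\in\{1,2,3\}$ $$\tau_j(\lambda)=\tau_j^o(\lambda)\,(1+o(1))\quad\text{as } |\lambda|\to\infty,\ \ |\lambda-\pi n|\ge\delta\ \text{ for all } n\in\mathbb Z .$$ For all $\tau,\lambda\in\mathbb C$, $$D(\tau,\lambda)=-\tau^3+\tau^2T(\lambda)-\tau e^{i\lambda}\widetilde T(\lambda)+e^{i\lambda},$$ and, for all $\lambda\in\mathbb C$ and any labelling of the multipliers, $$\det\psi(\lambda)=e^{i\lambda}=\tau_1\tau_2\tau_3,\qquad \widetilde T(\lambda)=\frac1{\tau_1}+\frac1{\tau_2}+\frac1{\tau_3}=e^{-i\lambda}(\tau_1\tau_2+\tau_2\tau_3+\tau_3\tau_1).$$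 (ii) The spectrum of $\mathcal L$ is $\sigma(\mathcal L)=\mathbb R=\mathfrak S_1\cup\mathfrak S_3$, and $\mathfrak S_2=\emptyset$. -/

import Mathlib

open MeasureTheory Filter Topology Asymptotics

namespace Manakov

noncomputable section

/-- The space `ℂ³` with its Euclidean norm. -/
abbrev C3 : Type := EuclideanSpace ℂ (Fin 3)

/-- The Hilbert space `L²(ℝ, ℂ³)`. -/
abbrev L2 : Type := Lp C3 2 (volume : Measure ℝ)

/-- `v = (v₁, v₂)` is 1-periodic and belongs to `L²(𝕋) ⊕ L²(𝕋)`, `𝕋 = ℝ/ℤ`. -/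
structure IsPotential (v : Fin 2 → ℝ → ℂ) : Prop where
  periodic : ∀ i, Function.Periodic (v i) 1
  memLp : ∀ i, MemLp (v i) 2 (volume.restrict (Set.Ioc (0 : ℝ) 1))

/-- The matrix `J = diag(1, -1, -1)`. -/
def J : Matrix (Fin 3) (Fin 3) ℂ := !![1, 0, 0; 0, -1, 0; 0, 0, -1]

/-- The matrix potential `V = [[0, v*], [v, 0]]`, where `v` is a column. -/
def V (v : Fin 2 → ℝ → ℂ) (x : ℝ) : Matrix (Fin 3) (Fin 3) ℂ :=
  !![0, star (v 0 x), star (v 1 x);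
     v 0 x, 0, 0;
     v 1 x, 0, 0]

/-- The value `i J p + V(x) w`; with `w = u(x)` and `p = u'(x)` this is `(iJu' + Vu)(x)`. -/
def expr (v : Fin 2 → ℝ → ℂ) (x : ℝ) (w p : C3) : C3 :=
  WithLp.toLp 2 (Complex.I • (J.mulVec p.ofLp) + (V v x).mulVec w.ofLp)

/-- `u` is locally absolutely continuous on `ℝ` and `iJu' + Vu = g` almost everywhere. -/
def Solves (v : Fin 2 → ℝ → ℂ) (u g : ℝ → C3) : Prop :=
  (∀ a b : ℝ, AbsolutelyContinuousOnInterval u a b) ∧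
    ∀ᵐ x : ℝ, ∃ p : C3, HasDerivAt u p x ∧ expr v x (u x) p = g x

/-- The `j`-th column of a matrix valued function. -/
def column (y : ℝ → Matrix (Fin 3) (Fin 3) ℂ) (j : Fin 3) (x : ℝ) : C3 :=
  WithLp.toLp 2 (fun i => y x i j)

/-- `y` is a matrix valued solution of `iJy' + Vy = z y`, `y(0) = 1`. -/
def IsFundamentalSolution (v : Fin 2 → ℝ → ℂ) (z : ℂ)
    (y : ℝ → Matrix (Fin 3) (Fin 3) ℂ) : Prop :=
  y 0 = 1 ∧ ∀ j, Solves v (column y j) (fun x => z • column y j x)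

/-- The fundamental solution `y(x, z)`. That it exists and is unique for every potential
is part of the main statement. -/
def fundamentalSolution (v : Fin 2 → ℝ → ℂ) (z : ℂ) : ℝ → Matrix (Fin 3) (Fin 3) ℂ :=
  Classical.epsilon (IsFundamentalSolution v z)

/-- The monodromy matrix `ψ(z) = y(1, z)`. -/
def monodromy (v : Fin 2 → ℝ → ℂ) (z : ℂ) : Matrix (Fin 3) (Fin 3) ℂ :=
  fundamentalSolution v z 1

/-- `D(τ, z) = det(ψ(z) - τ)`. -/
def D (v : Fin 2 → ℝ → ℂ) (τ z : ℂ) : ℂ := (monodromy v z - τ • 1).det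

/-- `T(z) = Tr ψ(z)`. -/
def T (v : Fin 2 → ℝ → ℂ) (z : ℂ) : ℂ := (monodromy v z).trace

/-- `T̃(z)`, the conjugate of `T` at the conjugate of `z`. -/
def Ttilde (v : Fin 2 → ℝ → ℂ) (z : ℂ) : ℂ := star (T v (star z))

/-- The multipliers: the eigenvalues of `ψ(z)`, repeated according to algebraic multiplicity. -/
def multipliers (v : Fin 2 → ℝ → ℂ) (z : ℂ) : Multiset ℂ := (monodromy v z).charpoly.roots

/-- The multipliers for `v = 0`, labelled as `e^{iz}, e^{iz}, e^{-iz}`. -/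
def freeMultiplier (j : Fin 3) (z : ℂ) : ℂ :=
  ![Complex.exp (Complex.I * z), Complex.exp (Complex.I * z), Complex.exp (-Complex.I * z)] j

/-- `|z| → ∞` with `|z - πn| ≥ δ` for all integers `n`. -/
def awayFilter (δ : ℝ) : Filter ℂ :=
  Bornology.cobounded ℂ ⊓ 𝓟 {z : ℂ | ∀ n : ℤ, δ ≤ ‖z - (Real.pi : ℂ) * (n : ℂ)‖}

open Classical in
/-- `𝔖ₖ`: the real `t` for which exactly `k` multipliers, counted with multiplicity,
have modulus one. -/
def spectralPart (v : Fin 2 → ℝ → ℂ) (k : ℕ) : Set ℝ :=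
  {t : ℝ | (multipliers v (t : ℂ)).countP (fun τ => ‖τ‖ = 1) = k}

lemma expr_zero (v : Fin 2 → ℝ → ℂ) (x : ℝ) : expr v x 0 0 = 0 := by
  simp [expr]

lemma expr_add (v : Fin 2 → ℝ → ℂ) (x : ℝ) (w p w' p' : C3) :
    expr v x (w + w') (p + p') = expr v x w p + expr v x w' p' := by
  ext i
  simp only [expr, WithLp.ofLp_add, Matrix.mulVec_add, smul_add, Pi.add_apply]
  ring

lemma expr_smul (v : Fin 2 → ℝ → ℂ) (x : ℝ) (c : ℂ) (w p : C3) :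
    expr v x (c • w) (c • p) = c • expr v x w p := by
  ext i
  simp only [expr, WithLp.ofLp_smul, Matrix.mulVec_smul, Pi.add_apply, Pi.smul_apply, smul_eq_mul]
  ring

/-- The graph of `𝓛 = iJ d/dx + V` in `L²(ℝ, ℂ³)` on its maximal domain: all `f ∈ L²` with a
locally absolutely continuous representative `u` such that `iJu' + Vu ∈ L²`. -/
def graph (v : Fin 2 → ℝ → ℂ) : Submodule ℂ (L2 × L2) where
  carrier := {q | ∃ u : ℝ → C3, q.1 =ᵐ[volume] u ∧ Solves v u q.2}
  zero_mem' := by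
    refine ⟨fun _ => 0, Lp.coeFn_zero _ _ _, ?_, ?_⟩
    · intro a b
      exact (LipschitzWith.const (0 : C3)).lipschitzOnWith.absolutelyContinuousOnInterval
    · filter_upwards [Lp.coeFn_zero C3 2 (volume : Measure ℝ)] with x hx
      exact ⟨0, hasDerivAt_const x 0, by rw [expr_zero]; exact hx.symm⟩
  add_mem' := by
    rintro ⟨f, g⟩ ⟨f', g'⟩ ⟨u, hf, hu, hg⟩ ⟨u', hf', hu', hg'⟩
    refine ⟨fun x => u x + u' x, ?_, fun a b => (hu a b).add (hu' a b), ?_⟩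
    · filter_upwards [Lp.coeFn_add f f', hf, hf'] with x h1 h2 h3
      simpa [h2, h3] using h1
    · filter_upwards [Lp.coeFn_add g g', hg, hg'] with x h1 h2 h3
      obtain ⟨p, hp, hpe⟩ := h2
      obtain ⟨p', hp', hpe'⟩ := h3
      refine ⟨p + p', hp.add hp', ?_⟩
      rw [expr_add, hpe, hpe']
      exact h1.symm
  smul_mem' := by
    rintro c ⟨f, g⟩ ⟨u, hf, hu, hg⟩
    refine ⟨fun x => c • u x, ?_, fun a b => (hu a b).const_smul c, ?_⟩
    · filter_upwards [Lp.coeFn_smul c f, hf] with x h1 h2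
      simpa [h2] using h1
    · filter_upwards [Lp.coeFn_smul c g, hg] with x h1 h2
      obtain ⟨p, hp, hpe⟩ := h2
      refine ⟨c • p, hp.const_smul c, ?_⟩
      rw [expr_smul, hpe]
      exact h1.symm

/-- The graph is single valued. -/
lemma graph_single_valued (v : Fin 2 → ℝ → ℂ) (q : L2 × L2) (hq : q ∈ graph v)
    (h0 : q.1 = 0) : q.2 = 0 := by
  obtain ⟨u, hf, hu, hg⟩ := hq
  have hc : Continuous u := by
    rw [continuous_iff_continuousAt]
    intro x
    have h := (hu (x - 1) (x + 1)).continuousOn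
    rw [Set.uIcc_of_le (by linarith)] at h
    exact h.continuousAt (Icc_mem_nhds (by linarith) (by linarith))
  have hu0 : u = fun _ => 0 := by
    refine (hc.ae_eq_iff_eq volume continuous_const).1 ?_
    rw [h0] at hf
    exact hf.symm.trans (Lp.coeFn_zero _ _ _)
  refine (Lp.eq_zero_iff_ae_eq_zero).2 ?_
  filter_upwards [hg] with x hx
  obtain ⟨p, hp, hpe⟩ := hx
  rw [hu0] at hp hpe
  have hp0 : p = 0 := hp.unique (hasDerivAt_const x 0)
  rw [← hpe, hp0]
  exact expr_zero v x

/-- The Manakov operator `𝓛 = iJ d/dx + V` in `L²(ℝ, ℂ³)`, an unbounded operator. -/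
def operator (v : Fin 2 → ℝ → ℂ) : L2 →ₗ.[ℂ] L2 := (graph v).toLinearPMap

lemma operator_graph (v : Fin 2 → ℝ → ℂ) : (operator v).graph = graph v :=
  (graph v).toLinearPMap_graph_eq (graph_single_valued v)

/-- `z` is in the resolvent set of the unbounded operator `A`: `A - z` maps the domain of `A`
bijectively onto the whole space and its inverse is bounded. -/
def IsResolventPoint {E : Type*} [NormedAddCommGroup E] [NormedSpace ℂ E]
    (A : E →ₗ.[ℂ] E) (z : ℂ) : Prop :=
  ∃ R : E →L[ℂ] E,
    (∀ g : E, ∃ h : R g ∈ A.domain, A ⟨R g, h⟩ - z • R g = g) ∧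
    ∀ f : A.domain, R (A f - z • (f : E)) = f

/-- The spectrum of an unbounded operator, the complement of its resolvent set. -/
def spectrumOf {E : Type*} [NormedAddCommGroup E] [NormedSpace ℂ E]
    (A : E →ₗ.[ℂ] E) : Set ℂ :=
  {z | ¬ IsResolventPoint A z}

end

end Manakov

/-!
Write `iJu' + Vu = zu` as a linear ODE with locally integrable coefficients. Since `V` is Hermitian,
the form `w* J u` of solutions at `z̄` and `z` is constant, so `ψ(z̄)* J ψ(z) = J`. With Liouville's
formula `det ψ = e^{iz}` this yields the characteristic polynomial, and for real `z` it makes the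
multipliers invariant under `τ ↦ 1 / τ̄`, so one or three of them lie on the unit circle. A uniform
Riemann–Lebesgue lemma in Duhamel's formula gives the trace up to `o(e^{|Im z|})`, and the cubic
`D(·, z)` is then so close to the free one that its roots can be matched with the free multipliers,
even near the points `πn`. The operator is self-adjoint, hence has real spectrum, and cutting off
a Bloch solution with a multiplier of modulus one produces Weyl sequences at every real point.
-/

namespace Manakov

/-! ### Absolutely continuous functions -/

section AbsoluteContinuity

lemma absolutelyContinuousOnInterval_of_dist_le {X Y : Type*} [PseudoMetricSpace X]
    [PseudoMetricSpace Y] {f : ℝ → X} {g : ℝ → Y} {K a b : ℝ}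
    (hg : AbsolutelyContinuousOnInterval g a b)
    (h : ∀ x y, dist (f x) (f y) ≤ K * dist (g x) (g y)) :
    AbsolutelyContinuousOnInterval f a b := by
  refine squeeze_zero (fun E => Finset.sum_nonneg fun i _ => dist_nonneg) (fun E => ?_)
    (by simpa using Tendsto.const_mul K hg)
  rw [Finset.mul_sum]
  exact Finset.sum_le_sum fun i _ => h _ _

lemma locallyIntegrable_of_intervalIntegrable {E : Type*} [NormedAddCommGroup E] {m : ℝ → E}
    (hm : ∀ a b, IntervalIntegrable m volume a b) : LocallyIntegrable m volume := by
  intro x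
  refine ⟨Set.Ioc (x - 1) (x + 1), Ioc_mem_nhds (by linarith) (by linarith), ?_⟩
  rw [← intervalIntegrable_iff_integrableOn_Ioc_of_le (by linarith)]
  exact hm _ _

variable {E F : Type*} [NormedAddCommGroup E] [NormedSpace ℝ E] [NormedAddCommGroup F]
  [NormedSpace ℝ F]

lemma absolutelyContinuousOnInterval_integral {m : ℝ → E}
    (hm : ∀ a b, IntervalIntegrable m volume a b) (c a b : ℝ) :
    AbsolutelyContinuousOnInterval (fun x => ∫ t in c..x, m t) a b := by
  have hnorm : AbsolutelyContinuousOnInterval (fun x => ∫ t in c..x, ‖m t‖) a b := by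
    refine ((hm (min c (min a b)) (max c (max a b))).norm
      |>.absolutelyContinuousOnInterval_intervalIntegral ?_).mono ?_
    · exact Set.mem_uIcc.2 (Or.inl ⟨min_le_left _ _, le_max_left _ _⟩)
    · rw [Set.uIcc_of_le (by simp : min c (min a b) ≤ max c (max a b)), Set.uIcc]
      exact Set.Icc_subset_Icc (min_le_right _ _) (le_max_right _ _)
  refine absolutelyContinuousOnInterval_of_dist_le (K := 1) hnorm fun x y => ?_
  rw [one_mul, dist_eq_norm, dist_eq_norm,
    intervalIntegral.integral_interval_sub_left (hm _ _) (hm _ _),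
    intervalIntegral.integral_interval_sub_left (hm _ _).norm (hm _ _).norm]
  exact intervalIntegral.norm_integral_le_abs_integral_norm

/-- `f` is locally absolutely continuous on `ℝ`, with almost everywhere derivative `m`. -/
def HasACDeriv (f m : ℝ → E) : Prop :=
  (∀ a b : ℝ, AbsolutelyContinuousOnInterval f a b) ∧ ∀ᵐ x : ℝ, HasDerivAt f (m x) x

namespace HasACDeriv

section Algebra

variable {f g m n : ℝ → E}

lemma congr_deriv (hf : HasACDeriv f m) (h : m =ᵐ[volume] n) : HasACDeriv f n :=
  ⟨hf.1, by filter_upwards [hf.2, h] with x hx hm; rwa [← hm]⟩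

lemma congr (hf : HasACDeriv f m) (hfg : ∀ x, f x = g x) (hmn : ∀ x, m x = n x) :
    HasACDeriv g n := by
  rwa [← funext hfg, ← funext hmn]

lemma const (c : E) : HasACDeriv (fun _ => c) (fun _ => 0) :=
  ⟨fun _ _ => (LipschitzWith.const c).lipschitzOnWith.absolutelyContinuousOnInterval,
    ae_of_all _ fun x => hasDerivAt_const x c⟩

lemma add (hf : HasACDeriv f m) (hg : HasACDeriv g n) :
    HasACDeriv (fun x => f x + g x) (fun x => m x + n x) :=
  ⟨fun a b => (hf.1 a b).add (hg.1 a b), by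
    filter_upwards [hf.2, hg.2] with x h₁ h₂ using h₁.add h₂⟩

lemma sub (hf : HasACDeriv f m) (hg : HasACDeriv g n) :
    HasACDeriv (fun x => f x - g x) (fun x => m x - n x) :=
  ⟨fun a b => (hf.1 a b).sub (hg.1 a b), by
    filter_upwards [hf.2, hg.2] with x h₁ h₂ using h₁.sub h₂⟩

lemma smul {𝕜 : Type*} [NormedField 𝕜] [NormedAlgebra ℝ 𝕜] [NormedSpace 𝕜 E]
    [IsScalarTower ℝ 𝕜 E] {φ φ' : ℝ → 𝕜} (hφ : HasACDeriv φ φ') (hf : HasACDeriv f m) :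
    HasACDeriv (fun x => φ x • f x) (fun x => φ x • m x + φ' x • f x) :=
  ⟨fun a b => (hφ.1 a b).smul (hf.1 a b), by
    filter_upwards [hφ.2, hf.2] with x h₁ h₂ using h₁.smul h₂⟩

lemma mul {𝕜 : Type*} [NormedField 𝕜] [NormedAlgebra ℝ 𝕜] {φ φ' χ χ' : ℝ → 𝕜}
    (hφ : HasACDeriv φ φ') (hχ : HasACDeriv χ χ') :
    HasACDeriv (fun x => φ x * χ x) (fun x => φ x * χ' x + φ' x * χ x) :=
  hφ.smul hχ

lemma clm_comp (L : E →L[ℝ] F) (hf : HasACDeriv f m) :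
    HasACDeriv (fun x => L (f x)) (fun x => L (m x)) :=
  ⟨fun a b => absolutelyContinuousOnInterval_of_dist_le (hf.1 a b) fun x y =>
      L.lipschitz.dist_le_mul (f x) (f y), by
    filter_upwards [hf.2] with x hx using L.hasFDerivAt.comp_hasDerivAt x hx⟩

lemma of_contDiff (hf : ContDiff ℝ 1 f) : HasACDeriv f (deriv f) :=
  ⟨fun _ _ => hf.contDiffOn.absolutelyContinuousOnInterval, ae_of_all _ fun x =>
    (hf.differentiable one_ne_zero x).hasDerivAt⟩

end Algebra

lemma star {f m : ℝ → ℂ} (hf : HasACDeriv f m) :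
    HasACDeriv (fun x => Star.star (f x)) (fun x => Star.star (m x)) :=
  hf.clm_comp (starL' ℝ : ℂ ≃L[ℝ] ℂ).toContinuousLinearMap

lemma exp (c : ℂ) : HasACDeriv (fun x : ℝ => Complex.exp (c * x))
    (fun x : ℝ => c * Complex.exp (c * x)) := by
  have hexp (x : ℝ) :
      HasDerivAt (fun x : ℝ => Complex.exp (c * x)) (c * Complex.exp (c * x)) x := by
    simpa [mul_comm] using ((hasDerivAt_id (x : ℂ)).const_mul c).cexp.comp_ofReal
  refine (of_contDiff ?_).congr (fun _ => rfl) fun x => (hexp x).deriv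
  exact (contDiff_const.mul Complex.ofRealCLM.contDiff).cexp

lemma pow {f m : ℝ → ℝ} (hf : HasACDeriv f m) (n : ℕ) :
    HasACDeriv (fun x => f x ^ (n + 1)) (fun x => (n + 1) * (m x * f x ^ n)) := by
  induction n with
  | zero => exact hf.congr (fun x => by simp) fun x => by simp
  | succ k ih =>
    exact (ih.mul hf).congr (fun x => (pow_succ _ _).symm) fun x => by push_cast; ring

section FundamentalTheorem

variable {f m : ℝ → E}

lemma continuous (hf : HasACDeriv f m) : Continuous f := by
  refine continuous_iff_continuousAt.2 fun x => ?_
  have h := (hf.1 (x - 1) (x + 1)).continuousOn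
  rw [Set.uIcc_of_le (by linarith)] at h
  exact h.continuousAt (Icc_mem_nhds (by linarith) (by linarith))

lemma eq_of_deriv_eq_zero (hf : HasACDeriv f (fun _ => 0)) (x y : ℝ) : f x = f y := by
  obtain ⟨C, hC⟩ := (hf.1 x y).const_of_ae_hasDerivAt_zero (by
    filter_upwards [hf.2] with t ht _ using ht)
  rw [hC x Set.left_mem_uIcc, hC y Set.right_mem_uIcc]

lemma integral [CompleteSpace E] (hm : ∀ a b, IntervalIntegrable m volume a b) (c : ℝ) :
    HasACDeriv (fun x => ∫ t in c..x, m t) m := by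
  refine ⟨absolutelyContinuousOnInterval_integral hm c, ?_⟩
  filter_upwards [LocallyIntegrable.ae_hasDerivAt_integral
    (locallyIntegrable_of_intervalIntegrable hm)] with x hx using hx c

variable [FiniteDimensional ℝ E]

lemma intervalIntegrable (hf : HasACDeriv f m) (a b : ℝ) : IntervalIntegrable m volume a b := by
  let B := Module.finBasis ℝ E
  let coord (i) : E →L[ℝ] ℝ := LinearMap.toContinuousLinearMap (B.coord i)
  have hcoord (i) : IntervalIntegrable (fun x => coord i (m x)) volume a b := by
    have hi := hf.clm_comp (coord i)
    refine (hi.1 a b).intervalIntegrable_deriv.congr_ae (ae_restrict_of_ae ?_)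
    filter_upwards [hi.2] with x hx using hx.deriv
  refine (IntervalIntegrable.sum Finset.univ (f := fun i x => coord i (m x) • B i) fun i _ =>
    ⟨(hcoord i).1.smul_const _, (hcoord i).2.smul_const _⟩).congr fun x _ => ?_
  simp [coord, B.sum_repr (m x)]

lemma integral_eq_sub (hf : HasACDeriv f m) (a b : ℝ) : ∫ t in a..b, m t = f b - f a := by
  have := FiniteDimensional.complete ℝ E
  have h := ((hf.sub (integral hf.intervalIntegrable a)).congr (fun _ => rfl)
    fun x => sub_self (m x)).eq_of_deriv_eq_zero b a
  rw [intervalIntegral.integral_same, sub_zero, sub_eq_iff_eq_add] at h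
  rw [h, add_sub_cancel_left]

lemma comp_add_const (hf : HasACDeriv f m) (c : ℝ) :
    HasACDeriv (fun x => f (x + c)) (fun x => m (x + c)) := by
  have := FiniteDimensional.complete ℝ E
  have hm (a b : ℝ) : IntervalIntegrable (fun x => m (x + c)) volume a b := by
    simpa using (hf.intervalIntegrable (a + c) (b + c)).comp_add_right c
  refine ((const (f c)).add (integral hm 0)).congr (fun x => ?_) fun x => zero_add _
  rw [intervalIntegral.integral_comp_add_right, hf.integral_eq_sub, zero_add, add_sub_cancel]

end FundamentalTheorem

end HasACDeriv

end AbsoluteContinuity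

/-! ### Linear Volterra equations with locally integrable coefficients -/

section Volterra

lemma abs_integral_mul_abs_primitive_pow {a : ℝ → ℝ} (ha : ∀ s t, IntervalIntegrable a volume s t)
    (h0 : ∀ t, 0 ≤ a t) (n : ℕ) (x₀ x : ℝ) :
    |∫ t in x₀..x, a t * |∫ s in x₀..t, a s| ^ n|
      = |∫ s in x₀..x, a s| ^ (n + 1) / (n + 1) := by
  set α : ℝ → ℝ := fun x => ∫ s in x₀..x, a s
  have hpow : ∫ t in x₀..x, a t * α t ^ n = α x ^ (n + 1) / (n + 1) := by
    have h := ((HasACDeriv.integral ha x₀).pow n).integral_eq_sub x₀ x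
    rw [intervalIntegral.integral_const_mul, intervalIntegral.integral_same,
      zero_pow n.succ_ne_zero, sub_zero] at h
    rw [eq_div_iff (by positivity), mul_comm, h]
  obtain ⟨σ, hσ, hα⟩ : ∃ σ : ℝ, |σ| = 1 ∧ ∀ t ∈ Set.uIcc x₀ x, |α t| = σ * α t := by
    rcases le_total x₀ x with hx | hx
    · refine ⟨1, abs_one, fun t ht => ?_⟩
      rw [Set.uIcc_of_le hx] at ht
      rw [one_mul, abs_of_nonneg (intervalIntegral.integral_nonneg ht.1 fun s _ => h0 s)]
    · refine ⟨-1, by simp, fun t ht => ?_⟩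
      rw [Set.uIcc_of_ge hx] at ht
      rw [neg_one_mul, abs_of_nonpos]
      rw [← neg_nonneg, ← intervalIntegral.integral_symm]
      exact intervalIntegral.integral_nonneg ht.2 fun s _ => h0 s
  calc |∫ t in x₀..x, a t * |α t| ^ n|
      = |∫ t in x₀..x, σ ^ n * (a t * α t ^ n)| := by
        congr 1
        refine intervalIntegral.integral_congr fun t ht => ?_
        simp only [hα t ht]
        ring
    _ = |α x| ^ (n + 1) / (n + 1) := by
        rw [intervalIntegral.integral_const_mul, hpow, abs_mul, abs_pow, hσ, one_pow, one_mul,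
          abs_div, abs_pow, abs_of_pos (by positivity : (0 : ℝ) < n + 1)]

variable {𝕜 E : Type*} [NontriviallyNormedField 𝕜] [NormedAddCommGroup E] [NormedSpace 𝕜 E]
  {A : ℝ → E →L[𝕜] E}

lemma intervalIntegrable_clm_apply {y : ℝ → E} {a b : ℝ} (hA : IntervalIntegrable A volume a b)
    (hy : Continuous y) : IntervalIntegrable (fun t => A t (y t)) volume a b := by
  refine (hA.norm.mul_continuousOn hy.norm.continuousOn).mono_fun ?_
    (ae_of_all _ fun t => ?_)
  · exact (isBoundedBilinearMap_apply (𝕜 := 𝕜)).continuous.comp_aestronglyMeasurable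
      (hA.def'.1.prodMk hy.aestronglyMeasurable)
  · simpa using (A t).le_opNorm (y t)

variable [NormedSpace ℝ E]

/-- The terms of the Picard series, which solves `y' = A y`, `y(x₀) = c`. -/
noncomputable def picard (A : ℝ → E →L[𝕜] E) (x₀ : ℝ) (c : E) : ℕ → ℝ → E
  | 0 => fun _ => c
  | n + 1 => fun x => ∫ t in x₀..x, A t (picard A x₀ c n t)

lemma continuous_picard (hA : ∀ a b, IntervalIntegrable A volume a b) (x₀ : ℝ)
    (c : E) (n : ℕ) : Continuous (picard A x₀ c n) := by
  induction n with
  | zero => exact continuous_const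
  | succ k ih =>
    exact intervalIntegral.continuous_primitive
      (fun a b => intervalIntegrable_clm_apply (hA a b) ih) x₀

lemma norm_picard_le (hA : ∀ a b, IntervalIntegrable A volume a b) (x₀ : ℝ)
    (c : E) (n : ℕ) (x : ℝ) :
    ‖picard A x₀ c n x‖ ≤ ‖c‖ * (|∫ s in x₀..x, ‖A s‖| ^ n / n.factorial) := by
  have hnorm (a b : ℝ) : IntervalIntegrable (fun t => ‖A t‖) volume a b := (hA a b).norm
  have hcont : Continuous fun x : ℝ => ∫ s in x₀..x, ‖A s‖ :=
    intervalIntegral.continuous_primitive hnorm x₀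
  induction n generalizing x with
  | zero => simp [picard]
  | succ k ih =>
    calc ‖picard A x₀ c (k + 1) x‖
        ≤ |∫ t in x₀..x, ‖c‖ / k.factorial * (‖A t‖ * |∫ s in x₀..t, ‖A s‖| ^ k)| := by
          refine intervalIntegral.norm_integral_le_abs_of_norm_le (ae_of_all _ fun t => ?_) ?_
          · refine ((A t).le_of_opNorm_le_of_le le_rfl (ih t)).trans_eq ?_
            ring
          · exact ((hnorm x₀ x).mul_continuousOn (hcont.abs.pow k).continuousOn).const_mul _
      _ = ‖c‖ * (|∫ s in x₀..x, ‖A s‖| ^ (k + 1) / (k + 1).factorial) := by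
          rw [intervalIntegral.integral_const_mul, abs_mul,
            abs_integral_mul_abs_primitive_pow hnorm (fun t => norm_nonneg _),
            Nat.factorial_succ, abs_of_nonneg (by positivity)]
          push_cast
          field_simp

lemma summable_picard [CompleteSpace E] (hA : ∀ a b, IntervalIntegrable A volume a b) (x₀ : ℝ)
    (c : E)
    (x : ℝ) : Summable fun n => picard A x₀ c n x :=
  .of_norm_bounded ((Real.summable_pow_div_factorial _).mul_left _) fun n =>
    norm_picard_le hA x₀ c n x

lemma continuous_tsum_picard [CompleteSpace E] (hA : ∀ a b, IntervalIntegrable A volume a b)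
    (x₀ : ℝ) (c : E) :
    Continuous fun x => ∑' n, picard A x₀ c n x := by
  have hcont : Continuous fun x : ℝ => |∫ s in x₀..x, ‖A s‖| :=
    (intervalIntegral.continuous_primitive (fun a b => (hA a b).norm) x₀).abs
  refine continuous_iff_continuousAt.2 fun x => ?_
  obtain ⟨K, hK⟩ := (isCompact_Icc (a := x - 1) (b := x + 1)).exists_bound_of_continuousOn
    hcont.continuousOn
  refine ContinuousOn.continuousAt (s := Set.Icc (x - 1) (x + 1)) ?_
    (Icc_mem_nhds (by linarith) (by linarith))
  refine continuousOn_tsum (fun n => (continuous_picard hA x₀ c n).continuousOn)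
    ((Real.summable_pow_div_factorial K).mul_left ‖c‖) fun n t ht => ?_
  refine (norm_picard_le hA x₀ c n t).trans ?_
  gcongr
  simpa using hK t ht

lemma hasSum_integral_picard [CompleteSpace E] (hA : ∀ a b, IntervalIntegrable A volume a b)
    (x₀ : ℝ) (c : E) (x : ℝ) :
    HasSum (fun n => picard A x₀ c (n + 1) x) (∫ t in x₀..x, A t (∑' n, picard A x₀ c n t)) := by
  have hcont : Continuous fun x : ℝ => |∫ s in x₀..x, ‖A s‖| :=
    (intervalIntegral.continuous_primitive (fun a b => (hA a b).norm) x₀).abs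
  refine intervalIntegral.hasSum_integral_of_dominated_convergence
    (fun n t => ‖A t‖ * (‖c‖ * (|∫ s in x₀..t, ‖A s‖| ^ n / n.factorial)))
    (fun n => (intervalIntegrable_clm_apply (hA x₀ x) (continuous_picard hA x₀ c n)).def'.1)
    (fun n => ae_of_all _ fun t _ =>
      (A t).le_of_opNorm_le_of_le le_rfl (norm_picard_le hA x₀ c n t))
    (ae_of_all _ fun t _ => ((Real.summable_pow_div_factorial _).mul_left _).mul_left _) ?_
    (ae_of_all _ fun t _ => (summable_picard hA x₀ c t).hasSum.mapL (A t))
  have hexp (t : ℝ) :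
      ∑' n : ℕ, ‖A t‖ * (‖c‖ * (|∫ s in x₀..t, ‖A s‖| ^ n / n.factorial))
        = ‖A t‖ * (‖c‖ * Real.exp |∫ s in x₀..t, ‖A s‖|) := by
    rw [tsum_mul_left, tsum_mul_left, Real.exp_eq_exp_ℝ, NormedSpace.exp_eq_tsum_div]
  simp only [hexp]
  exact (hA x₀ x).norm.mul_continuousOn (continuous_const.mul hcont.rexp).continuousOn

theorem exists_hasACDeriv_clm_apply [CompleteSpace E]
    (hA : ∀ a b, IntervalIntegrable A volume a b) (x₀ : ℝ) (c : E) :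
    ∃ y : ℝ → E, y x₀ = c ∧ HasACDeriv y (fun x => A x (y x)) := by
  set y : ℝ → E := fun x => ∑' n, picard A x₀ c n x
  have hy (x : ℝ) : c + ∫ t in x₀..x, A t (y t) = y x := by
    rw [← (hasSum_integral_picard hA x₀ c x).tsum_eq]
    exact (summable_picard hA x₀ c x).tsum_eq_zero_add.symm
  refine ⟨y, by simp [← hy x₀], ?_⟩
  have hint (a b : ℝ) : IntervalIntegrable (fun t => A t (y t)) volume a b :=
    intervalIntegrable_clm_apply (hA a b) (continuous_tsum_picard hA x₀ c)
  exact ((HasACDeriv.const c).add (HasACDeriv.integral hint x₀)).congr hy fun x => zero_add _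

end Volterra

/-! ### The differential equation -/

namespace IsPotential

variable {v : Fin 2 → ℝ → ℂ}

lemma intervalIntegrable (hv : IsPotential v) (i : Fin 2) (a b : ℝ) :
    IntervalIntegrable (v i) volume a b := by
  refine (hv.periodic i).intervalIntegrable (t := 0) one_ne_zero ?_ a b
  rw [zero_add, intervalIntegrable_iff_integrableOn_Ioc_of_le zero_le_one]
  exact (hv.memLp i).integrable one_le_two

lemma intervalIntegrable_star (hv : IsPotential v) (i : Fin 2) (a b : ℝ) :
    IntervalIntegrable (fun x => star (v i x)) volume a b :=
  (hv.intervalIntegrable i a b).mono_fun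
    (continuous_star.comp_aestronglyMeasurable (hv.intervalIntegrable i a b).def'.1)
    (ae_of_all _ fun x => (norm_star (v i x)).le)

lemma intervalIntegrable_norm_sq (hv : IsPotential v) (i : Fin 2) (a b : ℝ) :
    IntervalIntegrable (fun x => ‖v i x‖ ^ 2) volume a b := by
  refine Function.Periodic.intervalIntegrable (t := 0) (T := 1) (fun x => ?_) one_ne_zero ?_ a b
  · simp only [hv.periodic i x]
  · rw [zero_add, intervalIntegrable_iff_integrableOn_Ioc_of_le zero_le_one]
    exact (memLp_two_iff_integrable_sq_norm (hv.memLp i).1).1 (hv.memLp i)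

lemma aestronglyMeasurable (hv : IsPotential v) (i : Fin 2) :
    AEStronglyMeasurable (v i) volume :=
  (locallyIntegrable_of_intervalIntegrable (hv.intervalIntegrable i)).aestronglyMeasurable

end IsPotential

section Equation

variable {v : Fin 2 → ℝ → ℂ}

lemma expr_apply_zero (v : Fin 2 → ℝ → ℂ) (x : ℝ) (w p : C3) :
    expr v x w p 0 = Complex.I * p 0 + (star (v 0 x) * w 1 + star (v 1 x) * w 2) := by
  simp [expr, J, V, dotProduct, Fin.sum_univ_three]

lemma expr_apply_one (v : Fin 2 → ℝ → ℂ) (x : ℝ) (w p : C3) :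
    expr v x w p 1 = -(Complex.I * p 1) + v 0 x * w 0 := by
  simp [expr, J, V, dotProduct, Fin.sum_univ_three]

lemma expr_apply_two (v : Fin 2 → ℝ → ℂ) (x : ℝ) (w p : C3) :
    expr v x w p 2 = -(Complex.I * p 2) + v 1 x * w 0 := by
  simp [expr, J, V, dotProduct, Fin.sum_univ_three]

/-- The derivative `-iJ(g - V(x) w)` prescribed by the equation `iJu' + Vu = g` at a point `x`
where `u` takes the value `w`. -/
noncomputable def slope (v : Fin 2 → ℝ → ℂ) (x : ℝ) (w g : C3) : C3 :=
  !₂[-Complex.I * (g 0 - star (v 0 x) * w 1 - star (v 1 x) * w 2),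
    Complex.I * (g 1 - v 0 x * w 0), Complex.I * (g 2 - v 1 x * w 0)]

lemma slope_apply_zero (x : ℝ) (w g : C3) :
    slope v x w g 0 = -Complex.I * (g 0 - star (v 0 x) * w 1 - star (v 1 x) * w 2) := rfl

lemma slope_apply_one (x : ℝ) (w g : C3) :
    slope v x w g 1 = Complex.I * (g 1 - v 0 x * w 0) := rfl

lemma slope_apply_two (x : ℝ) (w g : C3) :
    slope v x w g 2 = Complex.I * (g 2 - v 1 x * w 0) := rfl

lemma expr_eq_iff (x : ℝ) (w p g : C3) : expr v x w p = g ↔ p = slope v x w g := by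
  have hI := Complex.I_mul_I
  simp only [PiLp.ext_iff, Fin.forall_fin_succ, Fin.forall_fin_zero, Fin.succ_zero_eq_one,
    Fin.succ_one_eq_two, expr_apply_zero, expr_apply_one, expr_apply_two, slope_apply_zero,
    slope_apply_one, slope_apply_two]
  refine and_congr ?_ (and_congr ?_ (and_congr ?_ Iff.rfl)) <;> constructor <;> intro h
  · linear_combination (-Complex.I) * h + p 0 * hI
  · linear_combination Complex.I * h
      - (g 0 - star (v 0 x) * w 1 - star (v 1 x) * w 2) * hI
  · linear_combination Complex.I * h + p 1 * hI
  · linear_combination (-Complex.I) * h - (g 1 - v 0 x * w 0) * hI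
  · linear_combination Complex.I * h + p 2 * hI
  · linear_combination (-Complex.I) * h - (g 2 - v 1 x * w 0) * hI

lemma solves_iff_hasACDeriv {u g : ℝ → C3} :
    Solves v u g ↔ HasACDeriv u (fun x => slope v x (u x) (g x)) :=
  and_congr_right fun _ => eventually_congr <| ae_of_all _ fun x => by
    simp only [expr_eq_iff, exists_eq_right]

lemma HasACDeriv.coord {ι : Type*} [Fintype ι] {u m : ℝ → EuclideanSpace ℂ ι}
    (hu : HasACDeriv u m) (i : ι) : HasACDeriv (fun x => u x i) (fun x => m x i) :=
  hu.clm_comp ((EuclideanSpace.proj (𝕜 := ℂ) i).restrictScalars ℝ)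

namespace Solves

variable {u w g h : ℝ → C3}

lemma hasACDeriv_zero (hu : Solves v u g) : HasACDeriv (fun x => u x 0)
    (fun x => -Complex.I * (g x 0 - star (v 0 x) * u x 1 - star (v 1 x) * u x 2)) :=
  (solves_iff_hasACDeriv.1 hu).coord 0

lemma hasACDeriv_one (hu : Solves v u g) :
    HasACDeriv (fun x => u x 1) (fun x => Complex.I * (g x 1 - v 0 x * u x 0)) :=
  (solves_iff_hasACDeriv.1 hu).coord 1

lemma hasACDeriv_two (hu : Solves v u g) :
    HasACDeriv (fun x => u x 2) (fun x => Complex.I * (g x 2 - v 1 x * u x 0)) :=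
  (solves_iff_hasACDeriv.1 hu).coord 2

lemma continuous (hu : Solves v u g) : Continuous u :=
  (solves_iff_hasACDeriv.1 hu).continuous

lemma congr (hu : Solves v u g) (hg : g =ᵐ[volume] h) : Solves v u h := by
  refine ⟨hu.1, ?_⟩
  filter_upwards [hu.2, hg] with x ⟨p, hp, he⟩ hx
  exact ⟨p, hp, he.trans hx⟩

lemma sub (hu : Solves v u g) (hw : Solves v w h) :
    Solves v (fun x => u x - w x) (fun x => g x - h x) := by
  refine ⟨fun a b => (hu.1 a b).sub (hw.1 a b), ?_⟩
  filter_upwards [hu.2, hw.2] with x ⟨p, hp, he⟩ ⟨q, hq, hf⟩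
  refine ⟨p - q, hp.sub hq, ?_⟩
  rw [← he, ← hf, eq_sub_iff_add_eq, ← expr_add, sub_add_cancel, sub_add_cancel]

lemma const_smul (c : ℂ) (hu : Solves v u g) :
    Solves v (fun x => c • u x) (fun x => c • g x) := by
  refine ⟨fun a b => (hu.1 a b).const_smul c, ?_⟩
  filter_upwards [hu.2] with x ⟨p, hp, he⟩
  exact ⟨c • p, hp.const_smul c, by rw [expr_smul, he]⟩

lemma comp_add_one (hv : IsPotential v) (hu : Solves v u g) :
    Solves v (fun x => u (x + 1)) (fun x => g (x + 1)) := by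
  refine solves_iff_hasACDeriv.2 ?_
  refine ((solves_iff_hasACDeriv.1 hu).comp_add_const 1).congr (fun _ => rfl) fun x => ?_
  simp only [slope, hv.periodic 0 x, hv.periodic 1 x]

end Solves

end Equation

section InitialValueProblem

variable {v : Fin 2 → ℝ → ℂ}

lemma intervalIntegrable_sum_entry_smul {ι F : Type*} [Fintype ι] [NormedAddCommGroup F]
    [NormedSpace ℂ F] {M : ℝ → Matrix ι ι ℂ} {a b : ℝ}
    (hM : ∀ i j, IntervalIntegrable (fun x => M x i j) volume a b) (B : ι → ι → F) :
    IntervalIntegrable (fun x => ∑ i, ∑ j, M x i j • B i j) volume a b := by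
  simp only [intervalIntegrable_iff] at hM ⊢
  exact integrable_finsetSum _ fun i _ => integrable_finsetSum _ fun j _ =>
    Integrable.smul_const (hM i j) _

lemma intervalIntegrable_toEuclideanCLM {ι : Type*} [Fintype ι] [DecidableEq ι]
    {M : ℝ → Matrix ι ι ℂ} {a b : ℝ}
    (hM : ∀ i j, IntervalIntegrable (fun x => M x i j) volume a b) :
    IntervalIntegrable (fun x => Matrix.toEuclideanCLM (𝕜 := ℂ) (M x)) volume a b := by
  have hsum (x : ℝ) : Matrix.toEuclideanCLM (𝕜 := ℂ) (M x)
      = ∑ i, ∑ j, M x i j • Matrix.toEuclideanCLM (𝕜 := ℂ) (Matrix.single i j (1 : ℂ)) := by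
    conv_lhs => rw [Matrix.matrix_eq_sum_single (M x)]
    simp only [map_sum, ← map_smul, Matrix.smul_single, smul_eq_mul, mul_one]
  simp only [hsum]
  exact intervalIntegrable_sum_entry_smul hM fun i j =>
    Matrix.toEuclideanCLM (𝕜 := ℂ) (Matrix.single i j (1 : ℂ))

theorem exists_solves (hv : IsPotential v) (z : ℂ) (x₀ : ℝ) (c : C3) :
    ∃ u, u x₀ = c ∧ Solves v u (fun x => z • u x) := by
  let M (x : ℝ) : Matrix (Fin 3) (Fin 3) ℂ :=
    !![-Complex.I * z, Complex.I * star (v 0 x), Complex.I * star (v 1 x);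
      -Complex.I * v 0 x, Complex.I * z, 0;
      -Complex.I * v 1 x, 0, Complex.I * z]
  have hM (i j : Fin 3) (a b : ℝ) : IntervalIntegrable (fun x => M x i j) volume a b := by
    have hc (c : ℂ) : IntervalIntegrable (fun _ => c) volume a b := intervalIntegrable_const
    have hvi (k : Fin 2) := (hv.intervalIntegrable k a b).const_mul (-Complex.I)
    have hvs (k : Fin 2) := (hv.intervalIntegrable_star k a b).const_mul Complex.I
    fin_cases i <;> fin_cases j
    exacts [hc _, hvs 0, hvs 1, hvi 0, hc _, hc _, hvi 1, hc _, hc _]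
  obtain ⟨u, hu0, hu⟩ := exists_hasACDeriv_clm_apply
    (fun a b => intervalIntegrable_toEuclideanCLM fun i j => hM i j a b) x₀ c
  refine ⟨u, hu0, solves_iff_hasACDeriv.2 (hu.congr (fun _ => rfl) fun x => ?_)⟩
  ext i
  rw [Matrix.ofLp_toEuclideanCLM]
  fin_cases i <;>
  · simp [M, slope, Matrix.mulVec, dotProduct, Fin.sum_univ_three]
    ring

end InitialValueProblem

section LagrangeIdentity

variable {v : Fin 2 → ℝ → ℂ} {u w g h : ℝ → C3}

/-- The indefinite form `w* J u`. -/
def form (w u : C3) : ℂ := star (w 0) * u 0 - star (w 1) * u 1 - star (w 2) * u 2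

lemma hasACDeriv_form (hw : Solves v w h) (hu : Solves v u g) :
    HasACDeriv (fun x => form (w x) (u x))
      (fun x => Complex.I * (inner ℂ (h x) (u x) - inner ℂ (w x) (g x))) := by
  refine (((hw.hasACDeriv_zero.star.mul hu.hasACDeriv_zero).sub
    (hw.hasACDeriv_one.star.mul hu.hasACDeriv_one)).sub
    (hw.hasACDeriv_two.star.mul hu.hasACDeriv_two)).congr (fun _ => rfl) fun x => ?_
  simp only [PiLp.inner_apply, Fin.sum_univ_three, RCLike.inner_apply, Complex.star_def, map_mul,
    map_sub, map_neg, Complex.conj_I, Complex.conj_conj]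
  ring

lemma form_eq_form {z : ℂ} (hw : Solves v w (fun x => star z • w x))
    (hu : Solves v u (fun x => z • u x)) (x y : ℝ) : form (w x) (u x) = form (w y) (u y) := by
  refine ((hasACDeriv_form hw hu).congr (fun _ => rfl) fun t => ?_).eq_of_deriv_eq_zero x y
  simp only [inner_smul_left, inner_smul_right]
  simp

lemma eq_zero_of_forall_form_eq_zero {p : C3} (hp : ∀ w, form w p = 0) : p = 0 := by
  ext i
  have h := hp (EuclideanSpace.single i 1)
  fin_cases i <;> simpa [form] using h

theorem Solves.eq_zero (hv : IsPotential v) {z : ℂ} (hu : Solves v u (fun x => z • u x))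
    {x₀ : ℝ} (h0 : u x₀ = 0) (x : ℝ) : u x = 0 := by
  refine eq_zero_of_forall_form_eq_zero fun p => ?_
  obtain ⟨w, rfl, hw⟩ := exists_solves hv (star z) x p
  rw [form_eq_form hw hu x x₀, h0]
  simp [form]

end LagrangeIdentity

/-! ### The monodromy matrix -/

section Monodromy

variable {v : Fin 2 → ℝ → ℂ} {z : ℂ} {y y₁ y₂ : ℝ → Matrix (Fin 3) (Fin 3) ℂ}

lemma exists_isFundamentalSolution (hv : IsPotential v) (z : ℂ) :
    ∃ y, IsFundamentalSolution v z y := by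
  choose u hu0 hu using fun j => exists_solves hv z 0 (EuclideanSpace.single j 1)
  refine ⟨fun x => Matrix.of fun i j => u j x i, ?_, hu⟩
  ext i j
  simp [hu0, Matrix.one_apply]

lemma existsUnique_isFundamentalSolution (hv : IsPotential v) (z : ℂ) :
    ∃! y, IsFundamentalSolution v z y := by
  obtain ⟨y, hy⟩ := exists_isFundamentalSolution hv z
  refine ⟨y, hy, fun w hw => ?_⟩
  ext x i j
  have hdiff : Solves v (fun x => column w j x - column y j x)
      (fun x => z • (column w j x - column y j x)) := by
    simpa only [smul_sub] using (hw.2 j).sub (hy.2 j)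
  have hzero := hdiff.eq_zero hv (x₀ := 0) (by simp [column, hw.1, hy.1]) x
  exact congrArg (fun p : C3 => p i) (sub_eq_zero.1 hzero)

lemma isFundamentalSolution_fundamentalSolution (hv : IsPotential v) (z : ℂ) :
    IsFundamentalSolution v z (fundamentalSolution v z) :=
  Classical.epsilon_spec (exists_isFundamentalSolution hv z)

lemma form_column (x : ℝ) (i j : Fin 3) :
    form (column y₁ i x) (column y₂ j x) = ((y₁ x).conjTranspose * J * y₂ x) i j := by
  simp [form, column, J, Matrix.mul_apply, Fin.sum_univ_three]
  ring

lemma J_mul_J : J * J = 1 := by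
  ext i j
  fin_cases i <;> fin_cases j <;> simp [J, Matrix.mul_apply, Fin.sum_univ_three]

lemma conjTranspose_mul_J_mul (h₁ : IsFundamentalSolution v (star z) y₁)
    (h₂ : IsFundamentalSolution v z y₂) (x : ℝ) : (y₁ x).conjTranspose * J * y₂ x = J := by
  ext i j
  rw [← form_column, form_eq_form (h₁.2 i) (h₂.2 j) x 0, form_column, h₁.1, h₂.1]
  simp

lemma conjTranspose_monodromy_mul_J_mul (hv : IsPotential v) (z : ℂ) :
    (monodromy v (star z)).conjTranspose * J * monodromy v z = J :=
  conjTranspose_mul_J_mul (isFundamentalSolution_fundamentalSolution hv _)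
    (isFundamentalSolution_fundamentalSolution hv _) 1

lemma exp_neg_I_mul_mul_exp (z : ℂ) :
    Complex.exp (-Complex.I * z) * Complex.exp (Complex.I * z) = 1 := by
  rw [← Complex.exp_add]
  simp

/-- Liouville's formula: the trace of `-iJ(z - V)` is `iz`. -/
lemma IsFundamentalSolution.det_eq (hy : IsFundamentalSolution v z y) (x : ℝ) :
    (y x).det = Complex.exp (Complex.I * z * x) := by
  have hconst : HasACDeriv (fun x : ℝ => Complex.exp (-(Complex.I * z) * x) * (y x).det)
      (fun _ => 0) := by
    have h0 j := (hy.2 j).hasACDeriv_zero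
    have h1 j := (hy.2 j).hasACDeriv_one
    have h2 j := (hy.2 j).hasACDeriv_two
    refine ((HasACDeriv.exp (-(Complex.I * z))).mul
      (((((((h0 0).mul ((h1 1).mul (h2 2))).sub ((h0 0).mul ((h1 2).mul (h2 1)))).sub
      ((h0 1).mul ((h1 0).mul (h2 2)))).add ((h0 1).mul ((h1 2).mul (h2 0)))).add
      ((h0 2).mul ((h1 0).mul (h2 1)))).sub ((h0 2).mul ((h1 1).mul (h2 0))))).congr
      (fun x => ?_) fun x => ?_
    · simp only [column, Matrix.det_fin_three]
      ring
    · simp only [column, PiLp.smul_apply, smul_eq_mul]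
      ring
  have h : Complex.exp (-(Complex.I * z) * x) * (y x).det = 1 := by
    simpa [hy.1] using hconst.eq_of_deriv_eq_zero x 0
  refine mul_left_cancel₀ (Complex.exp_ne_zero (-(Complex.I * z) * x)) (h.trans ?_)
  rw [← Complex.exp_add, neg_mul, neg_add_cancel, Complex.exp_zero]

lemma det_monodromy (hv : IsPotential v) (z : ℂ) :
    (monodromy v z).det = Complex.exp (Complex.I * z) := by
  simpa [monodromy] using (isFundamentalSolution_fundamentalSolution hv z).det_eq 1

lemma trace_adjugate_monodromy (hv : IsPotential v) (z : ℂ) :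
    (monodromy v z).adjugate.trace = Complex.exp (Complex.I * z) * Ttilde v z := by
  have hinv : (J * (monodromy v (star z)).conjTranspose * J) * monodromy v z = 1 := by
    rw [mul_assoc, mul_assoc, ← mul_assoc _ J, conjTranspose_monodromy_mul_J_mul hv, J_mul_J]
  have hadj : (monodromy v z).adjugate
      = Complex.exp (Complex.I * z) • (J * (monodromy v (star z)).conjTranspose * J) := by
    calc (monodromy v z).adjugate
        = ((J * (monodromy v (star z)).conjTranspose * J) * monodromy v z)
          * (monodromy v z).adjugate := by rw [hinv, one_mul]
      _ = _ := by rw [mul_assoc, Matrix.mul_adjugate, det_monodromy hv, Matrix.mul_smul, mul_one]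
  rw [hadj, Matrix.trace_smul, Matrix.trace_mul_comm, ← mul_assoc, J_mul_J, one_mul,
    Matrix.trace_conjTranspose]
  rfl

lemma det_sub_smul_one {R : Type*} [CommRing R] (M : Matrix (Fin 3) (Fin 3) R) (τ : R) :
    (M - τ • 1).det = -τ ^ 3 + τ ^ 2 * M.trace - τ * M.adjugate.trace + M.det := by
  simp [Matrix.det_fin_three, Matrix.trace_fin_three, Matrix.adjugate_fin_three]
  ring

lemma D_eq (hv : IsPotential v) (τ z : ℂ) :
    D v τ z = -τ ^ 3 + τ ^ 2 * T v z - τ * Complex.exp (Complex.I * z) * Ttilde v z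
      + Complex.exp (Complex.I * z) := by
  rw [D, det_sub_smul_one, trace_adjugate_monodromy hv, det_monodromy hv, T]
  ring

end Monodromy

/-! ### The multipliers -/

section Multipliers

variable {v : Fin 2 → ℝ → ℂ} {z a b c : ℂ}

lemma eval_charpoly_monodromy (τ : ℂ) : (monodromy v z).charpoly.eval τ = -D v τ z := by
  have h : Matrix.scalar (Fin 3) τ - monodromy v z = -(monodromy v z - τ • 1) := by
    rw [neg_sub, Matrix.scalar_apply, ← Matrix.smul_one_eq_diagonal]
  rw [Matrix.eval_charpoly, D, h, Matrix.det_neg]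
  simp [pow_succ]

lemma exists_multipliers_eq (v : Fin 2 → ℝ → ℂ) (z : ℂ) :
    ∃ a b c : ℂ, multipliers v z = {a, b, c} := by
  refine Multiset.card_eq_three.1 ?_
  rw [multipliers, IsAlgClosed.card_roots_eq_natDegree, Matrix.charpoly_natDegree_eq_dim]
  rfl

lemma D_eq_of_multipliers (h : multipliers v z = {a, b, c}) (τ : ℂ) :
    D v τ z = -((τ - a) * (τ - b) * (τ - c)) := by
  have hprod := (IsAlgClosed.splits (monodromy v z).charpoly).eq_prod_roots_of_monic
    (Matrix.charpoly_monic _)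
  have heval : ((monodromy v z).charpoly).eval τ = (τ - a) * ((τ - b) * (τ - c)) := by
    rw [hprod, ← multipliers, h]
    simp
  rw [mul_assoc, ← heval, eval_charpoly_monodromy, neg_neg]

lemma D_eq_zero_iff (h : multipliers v z = {a, b, c}) (τ : ℂ) :
    D v τ z = 0 ↔ τ = a ∨ τ = b ∨ τ = c := by
  simp only [D_eq_of_multipliers h, neg_eq_zero, mul_eq_zero, sub_eq_zero, or_assoc]

lemma vieta_multipliers (hv : IsPotential v) (h : multipliers v z = {a, b, c}) :
    a + b + c = T v z ∧ a * b + b * c + c * a = Complex.exp (Complex.I * z) * Ttilde v z ∧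
      a * b * c = Complex.exp (Complex.I * z) := by
  have h0 := (D_eq_of_multipliers h 0).symm.trans (D_eq hv 0 z)
  have h1 := (D_eq_of_multipliers h 1).symm.trans (D_eq hv 1 z)
  have h2 := (D_eq_of_multipliers h (-1)).symm.trans (D_eq hv (-1) z)
  refine ⟨?_, ?_, ?_⟩
  · linear_combination (h1 + h2) / 2 - h0
  · linear_combination (h2 - h1) / 2
  · linear_combination h0

lemma multipliers_identities (hv : IsPotential v) (h : multipliers v z = {a, b, c}) :
    Complex.exp (Complex.I * z) = a * b * c ∧
      Ttilde v z = 1 / a + 1 / b + 1 / c ∧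
      Ttilde v z = Complex.exp (-Complex.I * z) * (a * b + b * c + c * a) := by
  obtain ⟨-, hpair, hprod⟩ := vieta_multipliers hv h
  have hne : a * b * c ≠ 0 := hprod ▸ Complex.exp_ne_zero _
  obtain ⟨⟨ha, hb⟩, hc⟩ : (a ≠ 0 ∧ b ≠ 0) ∧ c ≠ 0 := by simpa only [mul_ne_zero_iff] using hne
  refine ⟨hprod.symm, ?_, ?_⟩
  · rw [← hprod] at hpair
    field_simp
    linear_combination -hpair
  · rw [hpair, ← mul_assoc, exp_neg_I_mul_mul_exp, one_mul]

lemma D_inv_star_eq_zero (hv : IsPotential v) {τ : ℂ} (h0 : τ ≠ 0) (h : D v τ z = 0) :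
    D v (star τ)⁻¹ (star z) = 0 := by
  have hE : star (Complex.exp (Complex.I * z)) * Complex.exp (Complex.I * star z) = 1 := by
    rw [Complex.star_def, ← Complex.exp_conj, ← Complex.exp_add]
    simp
  have hT : Ttilde v (star z) = star (T v z) := by rw [Ttilde, star_star]
  have hT' : star (Ttilde v z) = T v (star z) := by rw [Ttilde, star_star]
  rw [D_eq hv] at h ⊢
  have h' := congrArg star h
  have h0' : star τ ≠ 0 := star_ne_zero.2 h0
  simp only [star_add, star_sub, star_neg, star_mul', star_pow, star_zero, hT, hT'] at h' ⊢
  generalize star τ = σ at *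
  generalize Complex.exp (Complex.I * star z) = e at *
  generalize star (Complex.exp (Complex.I * z)) = e' at *
  field_simp
  linear_combination (-e) * h' + (1 - σ * T v (star z)) * hE

lemma exists_norm_eq_one (habc : ‖a‖ * ‖b‖ * ‖c‖ = 1)
    (ha : (star a)⁻¹ = a ∨ (star a)⁻¹ = b ∨ (star a)⁻¹ = c) :
    ‖a‖ = 1 ∨ ‖b‖ = 1 ∨ ‖c‖ = 1 := by
  have ha0 : ‖a‖ ≠ 0 := by rintro h; simp [h] at habc
  rcases ha with h | h | h <;> replace h := congrArg norm h <;> rw [norm_inv, norm_star] at h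
  · left
    have hsq := mul_inv_cancel₀ ha0
    rw [h, ← sq] at hsq
    exact (pow_eq_one_iff_of_nonneg (norm_nonneg a) two_ne_zero).1 hsq
  · right; right
    rwa [← h, mul_inv_cancel₀ ha0, one_mul] at habc
  · right; left
    rwa [← h, mul_right_comm, mul_inv_cancel₀ ha0, one_mul] at habc

open Classical in
lemma countP_norm_eq_one (habc : ‖a‖ * ‖b‖ * ‖c‖ = 1) (h : ‖a‖ = 1 ∨ ‖b‖ = 1 ∨ ‖c‖ = 1) :
    Multiset.countP (fun τ : ℂ => ‖τ‖ = 1) {a, b, c} = 1 ∨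
      Multiset.countP (fun τ : ℂ => ‖τ‖ = 1) {a, b, c} = 3 := by
  simp only [Multiset.insert_eq_cons, ← Multiset.cons_zero, Multiset.countP_cons,
    Multiset.countP_zero, zero_add]
  by_cases h1 : ‖a‖ = 1 <;> by_cases h2 : ‖b‖ = 1 <;> by_cases h3 : ‖c‖ = 1 <;> simp_all

open Classical in
lemma countP_multipliers (hv : IsPotential v) (t : ℝ) :
    (multipliers v t).countP (fun τ => ‖τ‖ = 1) = 1 ∨
      (multipliers v t).countP (fun τ => ‖τ‖ = 1) = 3 := by
  obtain ⟨a, b, c, h⟩ := exists_multipliers_eq v t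
  have hn : ‖a‖ * ‖b‖ * ‖c‖ = 1 := by
    rw [← norm_mul, ← norm_mul, (vieta_multipliers hv h).2.2, mul_comm,
      Complex.norm_exp_ofReal_mul_I]
  have ha0 : a ≠ 0 := by rintro rfl; simp at hn
  have hrefl := D_inv_star_eq_zero hv ha0 ((D_eq_zero_iff h a).2 (.inl rfl))
  rw [Complex.star_def, Complex.conj_ofReal] at hrefl
  rw [h]
  exact countP_norm_eq_one hn (exists_norm_eq_one hn ((D_eq_zero_iff h _).1 hrefl))

lemma spectralPart_one_union_three (hv : IsPotential v) :
    spectralPart v 1 ∪ spectralPart v 3 = Set.univ :=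
  Set.eq_univ_of_forall fun t => countP_multipliers hv t

lemma spectralPart_two (hv : IsPotential v) : spectralPart v 2 = ∅ := by
  refine Set.eq_empty_of_forall_notMem fun t ht => ?_
  have ht' : Multiset.countP _ _ = 2 := ht
  rcases countP_multipliers hv t with h | h <;> rw [h] at ht' <;> omega

end Multipliers

/-! ### Oscillatory integrals -/

section Oscillatory

lemma norm_exp_I_mul_le (z : ℂ) {r L : ℝ} (hr : |r| ≤ L) :
    ‖Complex.exp (Complex.I * z * r)‖ ≤ Real.exp (|z.im| * L) := by
  have hre : (Complex.I * z * r).re = -(z.im * r) := by simp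
  rw [Complex.norm_exp, hre]
  refine Real.exp_le_exp.2 ((neg_le_abs _).trans ?_)
  rw [abs_mul]
  exact mul_le_mul_of_nonneg_left hr (abs_nonneg _)

/-- The oscillatory integral `∫ₛˣ e^{iz((t-s)-(x-t))} f(t) dt`: the phase picked up by a wave that
travels from `s` to `t` with phase speed `z`, and from `t` to `x` with phase speed `-z`. -/
noncomputable def oscInt (f : ℝ → ℂ) (z : ℂ) (s x : ℝ) : ℂ :=
  ∫ t in s..x, Complex.exp (Complex.I * z * (2 * t - s - x : ℝ)) * f t

variable {f g : ℝ → ℂ} {z : ℂ} {s x : ℝ}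

lemma norm_oscInt_le (hf : IntervalIntegrable f volume s x) (hsx : s ≤ x) :
    ‖oscInt f z s x‖ ≤ (∫ t in s..x, ‖f t‖) * Real.exp (|z.im| * (x - s)) := by
  rw [← intervalIntegral.integral_mul_const]
  refine intervalIntegral.norm_integral_le_of_norm_le hsx (ae_of_all _ fun t ht => ?_)
    (hf.norm.mul_const _)
  rw [norm_mul, mul_comm]
  refine mul_le_mul_of_nonneg_left (norm_exp_I_mul_le z ?_) (norm_nonneg _)
  exact abs_le.2 ⟨by linarith [ht.1], by linarith [ht.2]⟩

lemma oscInt_add (hf : IntervalIntegrable f volume s x) (hg : IntervalIntegrable g volume s x) :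
    oscInt (fun t => f t + g t) z s x = oscInt f z s x + oscInt g z s x := by
  have hc : Continuous fun t : ℝ => Complex.exp (Complex.I * z * (2 * t - s - x : ℝ)) := by fun_prop
  simp only [oscInt, mul_add]
  exact intervalIntegral.integral_add (hf.continuousOn_mul hc.continuousOn)
    (hg.continuousOn_mul hc.continuousOn)

lemma oscInt_eq_exp_mul (f : ℝ → ℂ) (z : ℂ) (s x : ℝ) :
    oscInt f z s x = Complex.exp (-(Complex.I * z) * x) * (Complex.exp (-(Complex.I * z) * s)
      * ∫ t in s..x, Complex.exp (2 * (Complex.I * z) * t) * f t) := by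
  rw [oscInt, ← intervalIntegral.integral_const_mul, ← intervalIntegral.integral_const_mul]
  refine intervalIntegral.integral_congr fun t _ => ?_
  simp only [← mul_assoc, ← Complex.exp_add]
  congr 2
  push_cast
  ring

lemma two_I_mul_oscInt (hg : ContDiff ℝ 1 g) (z : ℂ) (s x : ℝ) :
    2 * Complex.I * z * oscInt g z s x
      = Complex.exp (Complex.I * z * (x - s : ℝ)) * g x
        - Complex.exp (Complex.I * z * (s - x : ℝ)) * g s - oscInt (deriv g) z s x := by
  have hce : Continuous fun t : ℝ => Complex.exp (2 * (Complex.I * z) * t) := by fun_prop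
  have hparts : 2 * (Complex.I * z) * ∫ t in s..x, Complex.exp (2 * (Complex.I * z) * t) * g t
      = Complex.exp (2 * (Complex.I * z) * x) * g x - Complex.exp (2 * (Complex.I * z) * s) * g s
        - ∫ t in s..x, Complex.exp (2 * (Complex.I * z) * t) * deriv g t := by
    rw [← ((HasACDeriv.exp (2 * (Complex.I * z))).mul (.of_contDiff hg)).integral_eq_sub,
      ← intervalIntegral.integral_const_mul, ← intervalIntegral.integral_sub]
    · exact intervalIntegral.integral_congr fun t _ => by ring
    · exact ((hce.mul (hg.continuous_deriv le_rfl)).add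
        ((continuous_const.mul hce).mul hg.continuous)).intervalIntegrable _ _
    · exact (hce.mul (hg.continuous_deriv le_rfl)).intervalIntegrable _ _
  set c := Complex.exp (-(Complex.I * z) * x) * Complex.exp (-(Complex.I * z) * s) with hc
  have hx : Complex.exp (Complex.I * z * (x - s : ℝ))
      = c * Complex.exp (2 * (Complex.I * z) * x) := by
    rw [hc, ← Complex.exp_add, ← Complex.exp_add]
    push_cast
    ring_nf
  have hs : Complex.exp (Complex.I * z * (s - x : ℝ))
      = c * Complex.exp (2 * (Complex.I * z) * s) := by
    rw [hc, ← Complex.exp_add, ← Complex.exp_add]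
    push_cast
    ring_nf
  rw [oscInt_eq_exp_mul, oscInt_eq_exp_mul, hx, hs]
  linear_combination c * hparts

/-- On subintervals of the unit interval, `oscInt f z s x` is at most `ρ` times the trivial
exponential bound `e^{|Im z| (x - s)}`. -/
def OscBound (f : ℝ → ℂ) (z : ℂ) (ρ : ℝ) : Prop :=
  ∀ ⦃s x : ℝ⦄, 0 ≤ s → s ≤ x → x ≤ 1 →
    ‖oscInt f z s x‖ ≤ ρ * Real.exp (|z.im| * (x - s))

lemma oscBound_integral_norm (hf : IntervalIntegrable f volume 0 1) (z : ℂ) :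
    OscBound f z (∫ t in (0 : ℝ)..1, ‖f t‖) := by
  intro s x hs hsx hx
  have hsub : Set.uIcc s x ⊆ Set.uIcc (0 : ℝ) 1 := by
    rw [Set.uIcc_of_le hsx, Set.uIcc_of_le zero_le_one]
    exact Set.Icc_subset_Icc hs hx
  refine (norm_oscInt_le (hf.mono_set hsub) hsx).trans ?_
  gcongr
  exact intervalIntegral.integral_mono_interval hs hsx hx
    (ae_of_all _ fun t => norm_nonneg _) hf.norm

lemma exists_oscBound_div_norm (hg : ContDiff ℝ 1 g) : ∃ C, ∀ z ≠ 0, OscBound g z (C / ‖z‖) := by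
  obtain ⟨K, hK⟩ := (isCompact_Icc (a := (0 : ℝ)) (b := 1)).exists_bound_of_continuousOn
    hg.continuous.continuousOn
  set L := ∫ t in (0 : ℝ)..1, ‖deriv g t‖
  refine ⟨(K + K + L) / 2, fun z hz s x hs hsx hx => ?_⟩
  set E := Real.exp (|z.im| * (x - s))
  have hderiv : ‖oscInt (deriv g) z s x‖ ≤ L * E :=
    oscBound_integral_norm ((hg.continuous_deriv le_rfl).intervalIntegrable _ _) z hs hsx hx
  have hboundary (r y : ℝ) (hr : |r| ≤ x - s) (hy : y ∈ Set.Icc (0 : ℝ) 1) :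
      ‖Complex.exp (Complex.I * z * r) * g y‖ ≤ K * E := by
    rw [norm_mul, mul_comm K]
    exact mul_le_mul (norm_exp_I_mul_le z hr) (hK y hy) (norm_nonneg _) (Real.exp_pos _).le
  have hx' := hboundary (x - s) x (abs_of_nonneg (by linarith)).le ⟨by linarith, hx⟩
  have hs' := hboundary (s - x) s (by rw [abs_sub_comm, abs_of_nonneg (by linarith)])
    ⟨hs, by linarith⟩
  have hnorm : 2 * ‖z‖ * ‖oscInt g z s x‖ ≤ (K + K + L) * E := by
    have h := congrArg norm (two_I_mul_oscInt hg z s x)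
    rw [norm_mul, norm_mul, norm_mul, Complex.norm_I, Complex.norm_two, mul_one] at h
    rw [h, add_mul, add_mul]
    exact norm_sub_le_of_le (norm_sub_le_of_le hx' hs') hderiv
  rw [div_mul_eq_mul_div, le_div_iff₀ (norm_pos_iff.2 hz)]
  linarith

lemma exists_contDiff_integral_norm_sub_lt (hf : IntervalIntegrable f volume 0 1) {ε : ℝ}
    (hε : 0 < ε) : ∃ g : ℝ → ℂ, ContDiff ℝ 1 g ∧ ∫ t in (0 : ℝ)..1, ‖f t - g t‖ < ε := by
  rw [intervalIntegrable_iff_integrableOn_Ioc_of_le zero_le_one] at hf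
  have hF : MemLp ((Set.Ioc (0 : ℝ) 1).indicator f) 1 volume :=
    memLp_one_iff_integrable.2 (hf.integrable_indicator measurableSet_Ioc)
  obtain ⟨g, hg⟩ := (SchwartzMap.denseRange_toLpCLM (F := ℂ) (E := ℝ) (p := 1)
    (μ := volume) ENNReal.one_ne_top).exists_dist_lt hF.toLp hε
  refine ⟨g, g.smooth 1, ?_⟩
  have hi : Integrable (fun t => ‖(Set.Ioc (0 : ℝ) 1).indicator f t - g t‖) volume :=
    ((hf.integrable_indicator measurableSet_Ioc).sub g.integrable).norm
  have heq : Set.EqOn (fun t => ‖(Set.Ioc (0 : ℝ) 1).indicator f t - g t‖)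
      (fun t => ‖f t - g t‖) (Set.Ioc 0 1) := fun t ht => by
    simp only [Set.indicator_of_mem ht]
  rw [intervalIntegral.integral_of_le zero_le_one, ← setIntegral_congr_fun measurableSet_Ioc heq]
  refine (setIntegral_le_integral hi (ae_of_all _ fun t => norm_nonneg _)).trans_lt ?_
  rw [dist_eq_norm, L1.norm_eq_integral_norm] at hg
  refine lt_of_eq_of_lt (integral_congr_ae ?_) hg
  filter_upwards [Lp.coeFn_sub hF.toLp (SchwartzMap.toLpCLM ℝ ℂ 1 volume g), hF.coeFn_toLp,
    SchwartzMap.coeFn_toLp g 1 volume] with t h₁ h₂ h₃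
  rw [h₁, Pi.sub_apply, h₂, SchwartzMap.toLpCLM_apply, h₃]

theorem eventually_oscBound (hf : IntervalIntegrable f volume 0 1) {ε : ℝ} (hε : 0 < ε) :
    ∀ᶠ z in Bornology.cobounded ℂ, OscBound f z ε := by
  obtain ⟨g, hg, hfg⟩ := exists_contDiff_integral_norm_sub_lt hf (half_pos hε)
  obtain ⟨C, hC⟩ := exists_oscBound_div_norm hg
  have hsmall : Tendsto (fun z : ℂ => C / ‖z‖) (Bornology.cobounded ℂ) (𝓝 0) :=
    tendsto_norm_cobounded_atTop.const_div_atTop C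
  filter_upwards [hsmall.eventually_le_const (half_pos hε), Bornology.eventually_ne_cobounded 0]
    with z hz hz0 s x hs hsx hx
  have hsub : Set.uIcc s x ⊆ Set.uIcc (0 : ℝ) 1 := by
    rw [Set.uIcc_of_le hsx, Set.uIcc_of_le zero_le_one]
    exact Set.Icc_subset_Icc hs hx
  have hgi (a b : ℝ) : IntervalIntegrable g volume a b := hg.continuous.intervalIntegrable _ _
  have hsplit := oscInt_add (z := z) ((hf.mono_set hsub).sub (hgi s x)) (hgi s x)
  simp only [sub_add_cancel] at hsplit
  have hdiff := oscBound_integral_norm (hf.sub (hgi 0 1)) z hs hsx hx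
  have hsmooth := hC z hz0 hs hsx hx
  set E := Real.exp (|z.im| * (x - s))
  calc ‖oscInt f z s x‖
      ≤ (∫ t in (0 : ℝ)..1, ‖f t - g t‖) * E + C / ‖z‖ * E :=
        hsplit ▸ (norm_add_le _ _).trans (add_le_add hdiff hsmooth)
    _ ≤ ε / 2 * E + ε / 2 * E := by gcongr
    _ = ε * E := by ring

end Oscillatory

/-! ### Asymptotics of the trace -/

section VariationOfConstants

variable {w h : ℝ → ℂ}

lemma HasACDeriv.sub_exp_mul_eq_integral {c : ℂ}
    (hw : HasACDeriv w (fun x => c * w x + h x)) (x : ℝ) :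
    w x - Complex.exp (c * x) * w 0 = ∫ s in (0 : ℝ)..x, Complex.exp (c * (x - s : ℝ)) * h s := by
  have hexp (s : ℝ) : Complex.exp (c * (x - s : ℝ))
      = Complex.exp (c * x) * Complex.exp (-c * s) := by
    rw [← Complex.exp_add]
    push_cast
    ring_nf
  have hint := (((HasACDeriv.exp (-c)).mul hw).congr (n := fun s => Complex.exp (-c * s) * h s)
    (fun _ => rfl) fun s => by ring).integral_eq_sub 0 x
  have hinv : Complex.exp (c * x) * Complex.exp (-c * x) = 1 := by
    simpa using (hexp x).symm
  simp only [hexp, mul_assoc]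
  rw [intervalIntegral.integral_const_mul, hint]
  simp only [Complex.ofReal_zero, mul_zero, Complex.exp_zero, one_mul]
  linear_combination (-w x) * hinv

lemma hasACDeriv_oscInt {f : ℝ → ℂ} (hf : ∀ a b, IntervalIntegrable f volume a b) (z : ℂ) (x : ℝ) :
    HasACDeriv (fun s => oscInt f z s x) (fun s => -(Complex.I * z) * oscInt f z s x
      - Complex.exp (-(Complex.I * z) * (x - s : ℝ)) * f s) := by
  let q (t : ℝ) : ℂ := Complex.exp (2 * (Complex.I * z) * t) * f t
  have hq (a b : ℝ) : IntervalIntegrable q volume a b :=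
    (hf a b).continuousOn_mul (by fun_prop)
  have hprim : HasACDeriv (fun s => ∫ t in s..x, q t) (fun s => -q s) :=
    ((HasACDeriv.const (∫ t in (0 : ℝ)..x, q t)).sub (.integral hq 0)).congr
      (fun s => intervalIntegral.integral_interval_sub_left (hq _ _) (hq _ _)) fun s => zero_sub _
  refine ((HasACDeriv.const (Complex.exp (-(Complex.I * z) * x))).mul
    ((HasACDeriv.exp (-(Complex.I * z))).mul hprim)).congr
    (fun s => (oscInt_eq_exp_mul f z s x).symm) fun s => ?_
  have hexp : Complex.exp (-(Complex.I * z) * (x - s : ℝ)) = Complex.exp (-(Complex.I * z) * x)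
      * Complex.exp (-(Complex.I * z) * s) * Complex.exp (2 * (Complex.I * z) * s) := by
    rw [← Complex.exp_add, ← Complex.exp_add]
    push_cast
    ring_nf
  rw [hexp, oscInt_eq_exp_mul]
  ring

lemma integral_exp_mul_mul_eq_oscInt {f : ℝ → ℂ} (hf : ∀ a b, IntervalIntegrable f volume a b)
    {z : ℂ} (hw : HasACDeriv w (fun s => Complex.I * z * w s + h s)) (x : ℝ) :
    ∫ s in (0 : ℝ)..x, Complex.exp (-(Complex.I * z) * (x - s : ℝ)) * (f s * w s)
      = oscInt f z 0 x * w 0 + ∫ s in (0 : ℝ)..x, oscInt f z s x * h s := by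
  have hosc := hasACDeriv_oscInt hf z x
  have hh : IntervalIntegrable h volume 0 x :=
    ((hw.intervalIntegrable 0 x).sub
      ((continuous_const.mul hw.continuous).intervalIntegrable 0 x)).congr_ae
      (ae_of_all _ fun s => add_sub_cancel_left _ _)
  have hint := ((hosc.mul hw).congr (n := fun s => oscInt f z s x * h s
      - Complex.exp (-(Complex.I * z) * (x - s : ℝ)) * (f s * w s))
    (fun _ => rfl) fun s => by ring).integral_eq_sub 0 x
  rw [intervalIntegral.integral_sub (hh.continuousOn_mul hosc.continuous.continuousOn)
    (((hf 0 x).mul_continuousOn hw.continuous.continuousOn).continuousOn_mul (by fun_prop))] at hint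
  have hxx : oscInt f z x x = 0 := intervalIntegral.integral_same
  rw [hxx] at hint
  linear_combination -hint

lemma norm_integral_kernel_mul_le {K g p : ℝ → ℂ} {ρ M c x : ℝ} (hρ : 0 ≤ ρ) (hx0 : 0 ≤ x)
    (hx1 : x ≤ 1) (hg : IntervalIntegrable g volume 0 1)
    (hK : ∀ s, 0 ≤ s → s ≤ x → ‖K s‖ ≤ ρ * Real.exp (c * (x - s)))
    (hp : ∀ s, 0 ≤ s → s ≤ 1 → ‖p s‖ ≤ M * Real.exp (c * s)) :
    ‖∫ s in (0 : ℝ)..x, K s * (g s * p s)‖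
      ≤ ρ * M * Real.exp (c * x) * ∫ s in (0 : ℝ)..1, ‖g s‖ := by
  have hM : 0 ≤ M := by simpa using (norm_nonneg _).trans (hp 0 le_rfl zero_le_one)
  have hsub : Set.uIcc 0 x ⊆ Set.uIcc (0 : ℝ) 1 := by
    rw [Set.uIcc_of_le hx0, Set.uIcc_of_le zero_le_one]
    exact Set.Icc_subset_Icc le_rfl hx1
  calc ‖∫ s in (0 : ℝ)..x, K s * (g s * p s)‖
      ≤ ∫ s in (0 : ℝ)..x, ρ * M * Real.exp (c * x) * ‖g s‖ := by
        refine intervalIntegral.norm_integral_le_of_norm_le hx0 (ae_of_all _ fun s hs => ?_)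
          ((hg.mono_set hsub).norm.const_mul _)
        have hexp : Real.exp (c * x) = Real.exp (c * (x - s)) * Real.exp (c * s) := by
          rw [← Real.exp_add]
          ring_nf
        rw [norm_mul, norm_mul, hexp]
        calc ‖K s‖ * (‖g s‖ * ‖p s‖)
            ≤ (ρ * Real.exp (c * (x - s))) * (‖g s‖ * (M * Real.exp (c * s))) := by
              gcongr
              exacts [hK s hs.1.le hs.2, hp s hs.1.le (hs.2.trans hx1)]
          _ = _ := by ring
    _ = ρ * M * Real.exp (c * x) * ∫ s in (0 : ℝ)..x, ‖g s‖ :=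
        intervalIntegral.integral_const_mul _ _
    _ ≤ _ := by
        gcongr
        exact intervalIntegral.integral_mono_interval le_rfl hx0 hx1
          (ae_of_all _ fun t => norm_nonneg _) hg.norm

end VariationOfConstants

section Trace

variable {v : Fin 2 → ℝ → ℂ} {z : ℂ} {u : ℝ → C3} {ρ M : ℝ}

lemma Solves.hasACDeriv_succ {g : ℝ → C3} (hu : Solves v u g) (k : Fin 2) :
    HasACDeriv (fun x => u x k.succ) (fun x => Complex.I * (g x k.succ - v k x * u x 0)) := by
  fin_cases k
  exacts [hu.hasACDeriv_one, hu.hasACDeriv_two]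

/-- The `L¹` norm of the potential over a period. -/
noncomputable def l1norm (v : Fin 2 → ℝ → ℂ) : ℝ := ∑ k, ∫ t in (0 : ℝ)..1, ‖v k t‖

lemma integral_norm_le_l1norm (v : Fin 2 → ℝ → ℂ) (k : Fin 2) :
    ∫ t in (0 : ℝ)..1, ‖v k t‖ ≤ l1norm v :=
  Finset.single_le_sum (f := fun k => ∫ t in (0 : ℝ)..1, ‖v k t‖) (fun _ _ =>
    intervalIntegral.integral_nonneg zero_le_one fun _ _ => norm_nonneg _) (Finset.mem_univ k)

/-- Eliminating the last two components leaves an integral equation for the first one whose kernel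
is oscillatory. -/
lemma first_component_sub_eq (hv : IsPotential v) (hu : Solves v u (fun x => z • u x)) (x : ℝ) :
    u x 0 - Complex.exp (-(Complex.I * z) * x) * u 0 0
      = ∑ k, (Complex.I * (oscInt (fun t => star (v k t)) z 0 x * u 0 k.succ)
        + ∫ s in (0 : ℝ)..x, oscInt (fun t => star (v k t)) z s x * (v k s * u s 0)) := by
  have hcont := hu.continuous
  have hcoord (i : Fin 3) : Continuous fun s => u s i := by fun_prop
  have h₀ := (hu.hasACDeriv_zero.congr (n := fun s => -(Complex.I * z) * u s 0
    + ∑ k, Complex.I * (star (v k s) * u s k.succ)) (fun _ => rfl) fun s => by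
      simp only [Fin.sum_univ_two, Fin.succ_zero_eq_one, Fin.succ_one_eq_two, PiLp.smul_apply,
        smul_eq_mul]
      ring).sub_exp_mul_eq_integral x
  have hsucc (k : Fin 2) := integral_exp_mul_mul_eq_oscInt (hv.intervalIntegrable_star k)
    ((hu.hasACDeriv_succ k).congr (n := fun s => Complex.I * z * u s k.succ
      + -Complex.I * (v k s * u s 0)) (fun _ => rfl) fun s => by
        simp only [PiLp.smul_apply, smul_eq_mul]
        ring) x
  simp only [Finset.mul_sum] at h₀
  rw [h₀, intervalIntegral.integral_finsetSum]
  · refine Finset.sum_congr rfl fun k _ => ?_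
    simp only [mul_left_comm _ Complex.I, mul_left_comm _ (-Complex.I)] at hsucc ⊢
    rw [intervalIntegral.integral_const_mul, hsucc, intervalIntegral.integral_const_mul]
    linear_combination (-∫ s in (0 : ℝ)..x,
      oscInt (fun t => star (v k t)) z s x * (v k s * u s 0)) * Complex.I_mul_I
  · exact fun k _ => (((hv.intervalIntegrable_star k 0 x).mul_continuousOn
      (hcoord k.succ).continuousOn).const_mul _).continuousOn_mul (by fun_prop)

lemma norm_first_component_sub_le (hv : IsPotential v)
    (hosc : ∀ k, OscBound (fun t => star (v k t)) z ρ) (hρ : 0 ≤ ρ)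
    (hu : Solves v u (fun x => z • u x))
    (hM : ∀ s, 0 ≤ s → s ≤ 1 → ‖u s 0‖ ≤ M * Real.exp (|z.im| * s))
    {x : ℝ} (hx0 : 0 ≤ x) (hx1 : x ≤ 1) :
    ‖u x 0 - Complex.exp (-(Complex.I * z) * x) * u 0 0‖
      ≤ ρ * ((∑ k : Fin 2, ‖u 0 k.succ‖) + l1norm v * M) * Real.exp (|z.im| * x) := by
  rw [first_component_sub_eq hv hu x]
  refine (norm_sum_le _ _).trans ((Finset.sum_le_sum fun k _ => norm_add_le_of_le
    (r₁ := ρ * Real.exp (|z.im| * x) * ‖u 0 k.succ‖) ?_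
    (norm_integral_kernel_mul_le hρ hx0 hx1 (hv.intervalIntegrable k 0 1)
      (fun s hs hsx => hosc k hs hsx hx1) hM)).trans (le_of_eq ?_))
  · rw [norm_mul, norm_mul, Complex.norm_I, one_mul]
    gcongr
    simpa using hosc k le_rfl hx0 hx1
  · rw [Finset.sum_add_distrib, ← Finset.mul_sum, ← Finset.mul_sum, l1norm]
    ring

/-- For small `ρ` the integral equation for the first component is a contraction in the norm
`sup ‖u₀(x)‖ e^{-|Im z| x}`. -/
lemma norm_first_component_le (hv : IsPotential v)
    (hosc : ∀ k, OscBound (fun t => star (v k t)) z ρ) (hρ : 0 ≤ ρ)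
    (hρv : ρ * l1norm v ≤ 1 / 2) (hu : Solves v u (fun x => z • u x)) {x : ℝ} (hx0 : 0 ≤ x)
    (hx1 : x ≤ 1) :
    ‖u x 0‖ ≤ 2 * (‖u 0 0‖ + ρ * ∑ k : Fin 2, ‖u 0 k.succ‖) * Real.exp (|z.im| * x) := by
  have hc : Continuous fun s => ‖u s 0‖ / Real.exp (|z.im| * s) :=
    hu.hasACDeriv_zero.continuous.norm.div (by fun_prop) fun s => (Real.exp_pos _).ne'
  obtain ⟨y, hy, hmax⟩ := (isCompact_Icc (a := (0 : ℝ)) (b := 1)).exists_isMaxOn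
    (by simp) hc.continuousOn
  set M := ‖u y 0‖ / Real.exp (|z.im| * y) with hMy
  have hM0 : 0 ≤ M := by positivity
  have hM (s : ℝ) (hs0 : 0 ≤ s) (hs1 : s ≤ 1) : ‖u s 0‖ ≤ M * Real.exp (|z.im| * s) :=
    (div_le_iff₀ (Real.exp_pos _)).1 (hmax ⟨hs0, hs1⟩)
  have hfree : ‖Complex.exp (-(Complex.I * z) * y) * u 0 0‖
      ≤ ‖u 0 0‖ * Real.exp (|z.im| * y) := by
    rw [norm_mul, mul_comm]
    gcongr
    simpa using norm_exp_I_mul_le z (r := -y) (by rw [abs_neg, abs_of_nonneg hy.1])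
  have hle : M ≤ ρ * ((∑ k : Fin 2, ‖u 0 k.succ‖) + l1norm v * M) + ‖u 0 0‖ := by
    rw [hMy, div_le_iff₀ (Real.exp_pos _), ← hMy, add_mul]
    simpa using norm_add_le_of_le (norm_first_component_sub_le hv hosc hρ hu hM hy.1 hy.2) hfree
  have hcontr : ρ * l1norm v * M ≤ 1 / 2 * M := mul_le_mul_of_nonneg_right hρv hM0
  refine (hM x hx0 hx1).trans (mul_le_mul_of_nonneg_right ?_ (Real.exp_pos _).le)
  linarith

lemma norm_succ_component_sub_le (hv : IsPotential v) (hu : Solves v u (fun x => z • u x))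
    (hM : ∀ s, 0 ≤ s → s ≤ 1 → ‖u s 0‖ ≤ M * Real.exp (|z.im| * s)) (k : Fin 2) :
    ‖u 1 k.succ - Complex.exp (Complex.I * z) * u 0 k.succ‖
      ≤ l1norm v * M * Real.exp |z.im| := by
  have hM0 : 0 ≤ M := by simpa using (norm_nonneg _).trans (hM 0 le_rfl zero_le_one)
  have h := ((hu.hasACDeriv_succ k).congr (n := fun s => Complex.I * z * u s k.succ
      + -Complex.I * (v k s * u s 0)) (fun _ => rfl) fun s => by
        simp only [PiLp.smul_apply, smul_eq_mul]
        ring).sub_exp_mul_eq_integral 1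
  simp only [Complex.ofReal_one, mul_one, mul_left_comm _ (-Complex.I)] at h
  rw [h, intervalIntegral.integral_const_mul, norm_mul, norm_neg, Complex.norm_I, one_mul]
  have hint := norm_integral_kernel_mul_le (ρ := 1)
    (K := fun s => Complex.exp (Complex.I * z * (1 - s : ℝ))) zero_le_one zero_le_one le_rfl
    (hv.intervalIntegrable k 0 1)
    (fun s _ hs => by
      rw [one_mul]
      exact norm_exp_I_mul_le z (abs_of_nonneg (sub_nonneg.2 hs)).le) hM
  rw [one_mul, mul_one] at hint
  refine hint.trans ?_
  rw [mul_comm, ← mul_assoc]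
  gcongr
  exact integral_norm_le_l1norm v k

/-- The trace `2 e^{iz} + e^{-iz}` of the monodromy matrix for `v = 0`. -/
noncomputable def freeTrace (z : ℂ) : ℂ :=
  2 * Complex.exp (Complex.I * z) + Complex.exp (-(Complex.I * z))

lemma norm_T_sub_le (hv : IsPotential v) (hosc : ∀ k, OscBound (fun t => star (v k t)) z ρ)
    (hρ : 0 ≤ ρ) (hρv : ρ * l1norm v ≤ 1 / 2) :
    ‖T v z - freeTrace z‖
      ≤ 6 * ρ * l1norm v * Real.exp |z.im| := by
  have hy := isFundamentalSolution_fundamentalSolution hv z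
  have hM (j : Fin 3) (s : ℝ) (hs0 : 0 ≤ s) (hs1 : s ≤ 1) :=
    norm_first_component_le hv hosc hρ hρv (hy.2 j) hs0 hs1
  have hfirst := norm_first_component_sub_le hv hosc hρ (hy.2 0) (hM 0) zero_le_one le_rfl
  have hsucc (k : Fin 2) := norm_succ_component_sub_le hv (hy.2 k.succ) (hM k.succ) k
  have hinit (i j : Fin 3) : column (fundamentalSolution v z) j 0 i
      = (1 : Matrix (Fin 3) (Fin 3) ℂ) i j := by simp [column, hy.1]
  have hmon (i j : Fin 3) : column (fundamentalSolution v z) j 1 i = monodromy v z i j := rfl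
  have h₀ : ‖monodromy v z 0 0 - Complex.exp (-(Complex.I * z))‖
      ≤ ρ * (l1norm v * 2) * Real.exp |z.im| := by
    simpa [hinit, hmon, Matrix.one_apply] using hfirst
  have h₁ : ‖monodromy v z 1 1 - Complex.exp (Complex.I * z)‖
      ≤ l1norm v * (2 * ρ) * Real.exp |z.im| := by
    simpa [hinit, hmon, Matrix.one_apply] using hsucc 0
  have h₂ : ‖monodromy v z 2 2 - Complex.exp (Complex.I * z)‖
      ≤ l1norm v * (2 * ρ) * Real.exp |z.im| := by
    simpa [hinit, hmon, Matrix.one_apply] using hsucc 1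
  have htrace : T v z - freeTrace z
      = (monodromy v z 0 0 - Complex.exp (-(Complex.I * z)))
        + (monodromy v z 1 1 - Complex.exp (Complex.I * z))
        + (monodromy v z 2 2 - Complex.exp (Complex.I * z)) := by
    rw [T, freeTrace, Matrix.trace_fin_three]
    ring
  rw [htrace]
  refine norm_add₃_le.trans ?_
  linarith

theorem eventually_norm_T_sub_le (hv : IsPotential v) {ε : ℝ} (hε : 0 < ε) :
    ∀ᶠ z in Bornology.cobounded ℂ,
      ‖T v z - freeTrace z‖
        ≤ ε * Real.exp |z.im| := by
  have hsmall (c : ℝ) : Tendsto (fun ρ : ℝ => c * ρ * l1norm v) (𝓝[>] 0) (𝓝 0) :=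
    (Continuous.tendsto' (by fun_prop) 0 0 (by simp)).mono_left nhdsWithin_le_nhds
  obtain ⟨ρ, hρ, hρv, hρε⟩ := (eventually_mem_nhdsWithin.and
    (((hsmall 1).eventually_le_const one_half_pos).and ((hsmall 6).eventually_le_const hε))).exists
  have hosc : ∀ᶠ z in Bornology.cobounded ℂ, ∀ k, OscBound (fun t => star (v k t)) z ρ :=
    eventually_all.2 fun k => eventually_oscBound (hv.intervalIntegrable_star k 0 1) hρ
  rw [one_mul] at hρv
  filter_upwards [hosc] with z hz
  exact (norm_T_sub_le hv hz (le_of_lt hρ) hρv).trans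
    (mul_le_mul_of_nonneg_right hρε (Real.exp_pos _).le)

end Trace

/-! ### Asymptotics of the multipliers -/

section NearOne

variable {ι : Type*} {s : Multiset ι} {f : ι → ℂ} {ε : ℝ}

lemma exists_mem_norm_lt_of_norm_prod_map_lt (hε : 0 ≤ ε)
    (h : ‖(s.map f).prod‖ < ε ^ s.card) : ∃ a ∈ s, ‖f a‖ < ε := by
  by_contra! hle
  refine h.not_ge ?_
  calc ε ^ s.card = (s.map fun _ => ε).prod := by
        rw [Multiset.map_const', Multiset.prod_replicate]
    _ ≤ (s.map fun a => ‖f a‖).prod :=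
        Multiset.prod_map_le_prod_map₀ _ _ (fun _ _ => hε) hle
    _ = ‖(s.map f).prod‖ := by
        simpa [Multiset.map_map] using ((normHom : ℂ →*₀ ℝ).map_multiset_prod (s.map f)).symm

lemma norm_inv_sub_one_le {x : ℂ} (hε : ε ≤ 1 / 2) (h : ‖x - 1‖ ≤ ε) : ‖x⁻¹ - 1‖ ≤ 2 * ε := by
  have hx : 1 / 2 ≤ ‖x‖ := by
    have htri : ‖(1 : ℂ)‖ ≤ ‖x‖ + ‖x - 1‖ := by simpa using norm_sub_le x (x - 1)
    rw [norm_one] at htri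
    linarith
  have hx0 : x ≠ 0 := norm_pos_iff.1 (by linarith)
  have hinv : x⁻¹ - 1 = -(x - 1) / x := by field_simp; ring
  rw [hinv, norm_div, norm_neg, div_le_iff₀ (by linarith)]
  nlinarith [norm_nonneg (x - 1)]

lemma norm_inv_mul_sub_one_le {x y : ℂ} (hε : ε ≤ 1 / 6) (hx : ‖x - 1‖ ≤ ε) (hy : ‖y - 1‖ ≤ ε) :
    ‖(x * y)⁻¹ - 1‖ ≤ 6 * ε := by
  have hxy : ‖x * y - 1‖ ≤ 3 * ε := by
    have hexp : x * y - 1 = (x - 1) * (y - 1) + (x - 1) + (y - 1) := by ring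
    rw [hexp]
    refine norm_add₃_le.trans ?_
    rw [norm_mul]
    nlinarith [norm_nonneg (x - 1), norm_nonneg (y - 1)]
  linarith [norm_inv_sub_one_le (by linarith) hxy]

-- The three hypotheses say that the numbers `x = f a`, `a ∈ s`, are nearly the roots of
-- `(x - 1)² (x - q)`, where `q` is their product.
lemma exists_two_norm_sub_one_le (hs : s.card = 3) (hε0 : 0 < ε) (hε1 : ε ≤ 1)
    (hprod : ‖(s.map f).prod‖ ≤ 1)
    (hsum : ‖(s.map f).sum - (2 + (s.map f).prod)‖ ≤ ε ^ 2 / 5)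
    (hone : ‖(s.map fun a => f a - 1).prod‖ < (ε ^ 2 / 5) ^ 3) :
    ∃ a b c, s = {a, b, c} ∧ ‖f a - 1‖ ≤ ε ∧ ‖f b - 1‖ ≤ ε := by
  obtain ⟨a, has, ha⟩ := exists_mem_norm_lt_of_norm_prod_map_lt (s := s)
    (f := fun a => f a - 1) (ε := ε ^ 2 / 5) (by positivity) (by rwa [hs])
  obtain ⟨t, rfl⟩ := Multiset.exists_cons_of_mem has
  have ht : t.card = 2 := by simpa using hs
  have hε : ε ^ 2 ≤ ε := pow_le_of_le_one hε0.le hε1 two_ne_zero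
  have hpair : ‖(t.map fun b => f b - 1).prod‖ < ε ^ t.card := by
    obtain ⟨b, c, rfl⟩ := Multiset.card_eq_two.1 ht
    have ha0 : f a ≠ 0 := by
      intro h0
      simp only [h0, zero_sub, norm_neg, norm_one] at ha
      linarith
    simp only [Multiset.insert_eq_cons, Multiset.map_cons, Multiset.map_singleton,
      Multiset.prod_cons, Multiset.prod_singleton, Multiset.sum_cons, Multiset.sum_singleton,
      Multiset.card_cons, Multiset.card_singleton] at hprod hsum ⊢
    have hid : (f b - 1) * (f c - 1) = f a * (f b * f c) * ((f a)⁻¹ - 1) + (f a - 1)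
        - (f a + (f b + f c) - (2 + f a * (f b * f c))) := by
      field_simp
      ring
    have hinv := norm_inv_sub_one_le (by linarith) ha.le
    rw [hid]
    refine (norm_sub_le _ _).trans_lt ?_
    have hadd := norm_add_le (f a * (f b * f c) * ((f a)⁻¹ - 1)) (f a - 1)
    rw [norm_mul] at hadd
    have hmul := mul_le_mul hprod hinv (norm_nonneg _) zero_le_one
    nlinarith
  obtain ⟨b, hbt, hb⟩ := exists_mem_norm_lt_of_norm_prod_map_lt hε0.le hpair
  obtain ⟨r, rfl⟩ := Multiset.exists_cons_of_mem hbt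
  obtain ⟨c, rfl⟩ := Multiset.card_eq_one.1 (by simpa using ht)
  exact ⟨a, b, c, rfl, by linarith, hb.le⟩

end NearOne

section Labelling

variable {v : Fin 2 → ℝ → ℂ} {z : ℂ} {ε : ℝ}

lemma tendsto_star_cobounded :
    Tendsto (star : ℂ → ℂ) (Bornology.cobounded ℂ) (Bornology.cobounded ℂ) := by
  rw [← tendsto_norm_atTop_iff_cobounded]
  simpa using tendsto_norm_cobounded_atTop

lemma eventually_norm_Ttilde_sub_le (hv : IsPotential v) (hε : 0 < ε) :
    ∀ᶠ z in Bornology.cobounded ℂ, ‖Ttilde v z - freeTrace (-z)‖ ≤ ε * Real.exp |z.im| := by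
  filter_upwards [tendsto_star_cobounded.eventually (eventually_norm_T_sub_le hv hε)] with z hz
  rw [← norm_star] at hz
  simpa [Ttilde, freeTrace, ← Complex.exp_conj] using hz

lemma norm_exp_mul_le {ξ w : ℂ} {r : ℝ} (hξ : ξ.re = -r) (hw : ‖w‖ ≤ ε * Real.exp r) :
    ‖Complex.exp ξ * w‖ ≤ ε := by
  rw [norm_mul, Complex.norm_exp, hξ]
  calc _ ≤ Real.exp (-r) * (ε * Real.exp r) := mul_le_mul_of_nonneg_left hw (Real.exp_pos _).le
    _ = ε := by rw [mul_left_comm, ← Real.exp_add, neg_add_cancel, Real.exp_zero, mul_one]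

lemma norm_exp_le_one {ξ : ℂ} {r : ℝ} (hξ : ξ.re = -|r|) : ‖Complex.exp ξ‖ ≤ 1 := by
  rw [Complex.norm_exp, hξ, Real.exp_le_one_iff]
  exact neg_nonpos.2 (abs_nonneg r)

lemma card_multipliers (v : Fin 2 → ℝ → ℂ) (z : ℂ) : (multipliers v z).card = 3 :=
  Multiset.card_eq_three.2 (exists_multipliers_eq v z)

lemma prod_multipliers_sub_exp (hv : IsPotential v) {a b c : ℂ}
    (h : multipliers v z = {a, b, c}) :
    (a - Complex.exp (Complex.I * z)) * (b - Complex.exp (Complex.I * z))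
        * (c - Complex.exp (Complex.I * z))
      = Complex.exp (Complex.I * z) ^ 2
        * (T v z - freeTrace z - (Ttilde v z - freeTrace (-z))) := by
  obtain ⟨hsum, hpair, hprod⟩ := vieta_multipliers hv h
  have hexp := exp_neg_I_mul_mul_exp z
  rw [neg_mul] at hexp
  rw [← hsum, freeTrace, freeTrace, mul_neg, neg_neg]
  linear_combination hprod - Complex.exp (Complex.I * z) * hpair
    + (-Complex.exp (Complex.I * z)) * hexp

lemma exists_two_ratios_of_im_nonpos (hv : IsPotential v) (hz : z.im ≤ 0) (hε0 : 0 < ε)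
    (hε1 : ε ≤ 1) {η : ℝ} (hη : η ≤ ε ^ 2 / 5) (hη' : 2 * η < (ε ^ 2 / 5) ^ 3)
    (hT : ‖T v z - freeTrace z‖ ≤ η * Real.exp |z.im|)
    (hTt : ‖Ttilde v z - freeTrace (-z)‖ ≤ η * Real.exp |z.im|) :
    ∃ a b c, multipliers v z = {a, b, c} ∧ ‖a / Complex.exp (Complex.I * z) - 1‖ ≤ ε ∧
      ‖b / Complex.exp (Complex.I * z) - 1‖ ≤ ε := by
  have hre : (-(Complex.I * z)).re = -|z.im| := by simp [abs_of_nonpos hz]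
  have hT' := norm_exp_mul_le hre hT
  have hTt' := norm_exp_mul_le hre hTt
  have hE := norm_exp_le_one hre
  obtain ⟨a, b, c, h⟩ := exists_multipliers_eq v z
  obtain ⟨hsum, -, hprod⟩ := vieta_multipliers hv h
  have hD := prod_multipliers_sub_exp hv h
  have hE0 := Complex.exp_ne_zero (Complex.I * z)
  simp only [freeTrace, mul_neg, neg_neg, Complex.exp_neg] at hT' hTt' hE hD
  generalize Complex.exp (Complex.I * z) = e at *
  have hprod' : a / e * (b / e * (c / e)) = e⁻¹ ^ 2 := by
    field_simp
    exact hprod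
  have hsum' : a / e + (b / e + c / e) - (2 + e⁻¹ ^ 2) = e⁻¹ * (T v z - (2 * e + e⁻¹)) := by
    rw [← hsum]
    field_simp
    ring
  have hone : (a / e - 1) * ((b / e - 1) * (c / e - 1))
      = e⁻¹ * (T v z - (2 * e + e⁻¹)) - e⁻¹ * (Ttilde v z - (2 * e⁻¹ + e)) := by
    rw [← mul_sub, ← mul_right_inj' (pow_ne_zero 3 hE0)]
    calc e ^ 3 * ((a / e - 1) * ((b / e - 1) * (c / e - 1)))
        = (a - e) * (b - e) * (c - e) := by field_simp
      _ = _ := by rw [hD]; field_simp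
  refine exists_two_norm_sub_one_le (f := (· / e)) (card_multipliers v z) hε0 hε1 ?_ ?_ ?_ <;>
    simp only [h, Multiset.insert_eq_cons, Multiset.map_cons, Multiset.map_singleton,
      Multiset.prod_cons, Multiset.prod_singleton, Multiset.sum_cons, Multiset.sum_singleton,
      hprod', hsum', hone]
  · rw [norm_pow]
    exact pow_le_one₀ (norm_nonneg _) hE
  · exact hT'.trans hη
  · linarith [norm_sub_le (e⁻¹ * (T v z - (2 * e + e⁻¹))) (e⁻¹ * (Ttilde v z - (2 * e⁻¹ + e)))]

lemma div_add_div_add_div_of_mul_eq {a b c e : ℂ} (ha : a ≠ 0) (hb : b ≠ 0) (hc : c ≠ 0)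
    (h : a * b * c = e) : e / a + (e / b + e / c) = a * b + b * c + c * a := by
  rw [← h]
  field_simp
  ring

lemma mul_div_sub_one_mul_of_mul_eq {a b c e : ℂ} (ha : a ≠ 0) (hb : b ≠ 0) (hc : c ≠ 0)
    (h : a * b * c = e) :
    e * ((e / a - 1) * ((e / b - 1) * (e / c - 1))) = -((a - e) * (b - e) * (c - e)) := by
  rw [← h]
  field_simp
  ring

lemma exists_two_ratios_of_im_nonneg (hv : IsPotential v) (hz : 0 ≤ z.im) (hε0 : 0 < ε)
    (hε1 : ε ≤ 1) {η : ℝ} (hη : η ≤ ε ^ 2 / 5) (hη' : 2 * η < (ε ^ 2 / 5) ^ 3)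
    (hT : ‖T v z - freeTrace z‖ ≤ η * Real.exp |z.im|)
    (hTt : ‖Ttilde v z - freeTrace (-z)‖ ≤ η * Real.exp |z.im|) :
    ∃ a b c, multipliers v z = {a, b, c} ∧ ‖Complex.exp (Complex.I * z) / a - 1‖ ≤ ε ∧
      ‖Complex.exp (Complex.I * z) / b - 1‖ ≤ ε := by
  have hre : (Complex.I * z).re = -|z.im| := by simp [abs_of_nonneg hz]
  have hT' := norm_exp_mul_le hre hT
  have hTt' := norm_exp_mul_le hre hTt
  have hE := norm_exp_le_one hre
  obtain ⟨a, b, c, h⟩ := exists_multipliers_eq v z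
  obtain ⟨-, hpair, hprod⟩ := vieta_multipliers hv h
  have hD := prod_multipliers_sub_exp hv h
  have hE0 := Complex.exp_ne_zero (Complex.I * z)
  simp only [freeTrace, mul_neg, neg_neg, Complex.exp_neg] at hT' hTt' hE hD
  generalize Complex.exp (Complex.I * z) = e at *
  obtain ⟨⟨ha, hb⟩, hc⟩ : (a ≠ 0 ∧ b ≠ 0) ∧ c ≠ 0 := by
    simpa only [← hprod, mul_ne_zero_iff] using hE0
  have hprod' : e / a * (e / b * (e / c)) = e ^ 2 := by
    field_simp
    exact hprod.symm
  have hsum' : e / a + (e / b + e / c) - (2 + e ^ 2) = e * (Ttilde v z - (2 * e⁻¹ + e)) := by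
    rw [div_add_div_add_div_of_mul_eq ha hb hc hprod, hpair]
    field_simp
  have hone : (e / a - 1) * ((e / b - 1) * (e / c - 1))
      = e * (Ttilde v z - (2 * e⁻¹ + e)) - e * (T v z - (2 * e + e⁻¹)) := by
    rw [← mul_right_inj' hE0]
    rw [mul_div_sub_one_mul_of_mul_eq ha hb hc hprod, hD]
    ring
  refine exists_two_norm_sub_one_le (f := (e / ·)) (card_multipliers v z) hε0 hε1 ?_ ?_ ?_ <;>
    simp only [h, Multiset.insert_eq_cons, Multiset.map_cons, Multiset.map_singleton,
      Multiset.prod_cons, Multiset.prod_singleton, Multiset.sum_cons, Multiset.sum_singleton,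
      hprod', hsum', hone]
  · rw [norm_pow]
    exact pow_le_one₀ (norm_nonneg _) hE
  · exact hTt'.trans hη
  · linarith [norm_sub_le (e * (Ttilde v z - (2 * e⁻¹ + e))) (e * (T v z - (2 * e + e⁻¹)))]

lemma eventually_exists_two_ratios (hv : IsPotential v) (hε0 : 0 < ε) (hε1 : ε ≤ 1 / 2) :
    ∀ᶠ z in Bornology.cobounded ℂ, ∃ a b c, multipliers v z = {a, b, c} ∧
      ‖a / Complex.exp (Complex.I * z) - 1‖ ≤ 2 * ε ∧
      ‖b / Complex.exp (Complex.I * z) - 1‖ ≤ 2 * ε := by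
  obtain ⟨η, hη0, hη, hη'⟩ : ∃ η : ℝ, 0 < η ∧ η ≤ ε ^ 2 / 5 ∧ 2 * η < (ε ^ 2 / 5) ^ 3 := by
    have hpow : (ε ^ 2 / 5) ^ 3 ≤ ε ^ 2 / 5 :=
      pow_le_of_le_one (by positivity) (by nlinarith) three_ne_zero
    have hpos : 0 < (ε ^ 2 / 5) ^ 3 := by positivity
    exact ⟨(ε ^ 2 / 5) ^ 3 / 3, by positivity, by linarith, by linarith⟩
  filter_upwards [eventually_norm_T_sub_le hv hη0, eventually_norm_Ttilde_sub_le hv hη0]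
    with z hT hTt
  rcases le_total z.im 0 with hz | hz
  · obtain ⟨a, b, c, h, ha, hb⟩ :=
      exists_two_ratios_of_im_nonpos hv hz hε0 (by linarith) hη hη' hT hTt
    exact ⟨a, b, c, h, by linarith, by linarith⟩
  · obtain ⟨a, b, c, h, ha, hb⟩ :=
      exists_two_ratios_of_im_nonneg hv hz hε0 (by linarith) hη hη' hT hTt
    exact ⟨a, b, c, h, by simpa only [inv_div] using norm_inv_sub_one_le hε1 ha,
      by simpa only [inv_div] using norm_inv_sub_one_le hε1 hb⟩

lemma freeMultiplier_ne_zero (j : Fin 3) (z : ℂ) : freeMultiplier j z ≠ 0 := by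
  fin_cases j <;> exact Complex.exp_ne_zero _

lemma eventually_exists_labelling (hv : IsPotential v) (hε : 0 < ε) :
    ∀ᶠ z in Bornology.cobounded ℂ, ∃ t : Fin 3 → ℂ, multipliers v z = {t 0, t 1, t 2} ∧
      ‖fun j => t j / freeMultiplier j z - 1‖ ≤ ε := by
  obtain ⟨κ, hκ0, hκ1, hκε⟩ : ∃ κ : ℝ, 0 < κ ∧ κ ≤ 1 / 12 ∧ 12 * κ ≤ ε :=
    ⟨min (1 / 12) (ε / 12), by positivity, min_le_left _ _,
      by linarith [min_le_right (1 / 12) (ε / 12)]⟩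
  filter_upwards [eventually_exists_two_ratios hv hκ0 (by linarith)] with z ⟨a, b, c, h, ha, hb⟩
  refine ⟨![a, b, c], h, (pi_norm_le_iff_of_nonneg hε.le).2 ?_⟩
  have hprod := (vieta_multipliers hv h).2.2
  have hE := Complex.exp_ne_zero (Complex.I * z)
  have hc : c / Complex.exp (-Complex.I * z)
      = (a / Complex.exp (Complex.I * z) * (b / Complex.exp (Complex.I * z)))⁻¹ := by
    obtain ⟨⟨ha0, hb0⟩, -⟩ : (a ≠ 0 ∧ b ≠ 0) ∧ c ≠ 0 := by
      simpa only [← hprod, mul_ne_zero_iff] using hE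
    rw [neg_mul, Complex.exp_neg]
    generalize Complex.exp (Complex.I * z) = e at *
    field_simp
    linear_combination hprod
  refine Fin.forall_fin_succ.2 ⟨?_, Fin.forall_fin_two.2 ⟨?_, ?_⟩⟩
  · exact ha.trans (by linarith)
  · exact hb.trans (by linarith)
  · have hthird := norm_inv_mul_sub_one_le (by linarith) ha hb
    rw [← hc] at hthird
    exact hthird.trans (by linarith)

lemma exists_minimal_labelling (v : Fin 2 → ℝ → ℂ) (z : ℂ) :
    ∃ t : Fin 3 → ℂ, multipliers v z = {t 0, t 1, t 2} ∧
      ∀ s : Fin 3 → ℂ, multipliers v z = {s 0, s 1, s 2} →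
        ‖fun j => t j / freeMultiplier j z - 1‖ ≤ ‖fun j => s j / freeMultiplier j z - 1‖ := by
  have hfin : {t : Fin 3 → ℂ | multipliers v z = {t 0, t 1, t 2}}.Finite := by
    refine (Set.Finite.pi' fun _ => (multipliers v z).finite_toSet).subset fun t ht i => ?_
    rw [Set.mem_ofPred_eq] at ht ⊢
    rw [ht]
    fin_cases i <;> simp
  obtain ⟨a, b, c, h⟩ := exists_multipliers_eq v z
  exact Set.exists_min_image _ (fun t : Fin 3 → ℂ => ‖fun j => t j / freeMultiplier j z - 1‖)
    hfin ⟨![a, b, c], h⟩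

-- Choosing a best labelling at every `z` makes the labelling independent of the error `ε`.
theorem exists_labelling_isEquivalent (hv : IsPotential v) :
    ∃ τ : Fin 3 → ℂ → ℂ,
      (∀ z, multipliers v z = {τ 0 z, τ 1 z, τ 2 z}) ∧
      ∀ j, τ j ~[Bornology.cobounded ℂ] freeMultiplier j := by
  choose t ht hmin using exists_minimal_labelling v
  refine ⟨fun j z => t z j, ht, fun j => IsLittleO.of_bound fun ε hε => ?_⟩
  filter_upwards [eventually_exists_labelling hv hε] with z ⟨s, hs, hsε⟩
  have hratio : ‖t z j / freeMultiplier j z - 1‖ ≤ ε :=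
    (norm_le_pi_norm (fun j => t z j / freeMultiplier j z - 1) j).trans ((hmin z s hs).trans hsε)
  calc ‖t z j - freeMultiplier j z‖
      = ‖t z j / freeMultiplier j z - 1‖ * ‖freeMultiplier j z‖ := by
        rw [← norm_mul, sub_mul, div_mul_cancel₀ _ (freeMultiplier_ne_zero j z), one_mul]
    _ ≤ ε * ‖freeMultiplier j z‖ := mul_le_mul_of_nonneg_right hratio (norm_nonneg _)

end Labelling

/-! ### Weak derivatives -/

section WeakDerivative

open scoped ContDiff

variable {E : Type*} [NormedAddCommGroup E] [NormedSpace ℝ E] [FiniteDimensional ℝ E]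

lemma HasACDeriv.integral_eq_zero {f m : ℝ → E} (hf : HasACDeriv f m) (hfi : Integrable f)
    (hm : Integrable m) : ∫ x, m x = 0 := by
  have htop : Tendsto f atTop (𝓝 (f 0 + ∫ x in Set.Ioi 0, m x)) := by
    refine ((intervalIntegral_tendsto_integral_Ioi 0 hm.integrableOn tendsto_id).const_add
      (f 0)).congr fun x => ?_
    rw [hf.integral_eq_sub, id, add_sub_cancel]
  have hbot : Tendsto f atBot (𝓝 (f 0 - ∫ x in Set.Iic 0, m x)) := by
    refine ((intervalIntegral_tendsto_integral_Iic 0 hm.integrableOn tendsto_id).const_sub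
      (f 0)).congr fun x => ?_
    rw [hf.integral_eq_sub, id, sub_sub_cancel]
  have hzero_top := IntegrableAtFilter.eq_zero_of_tendsto (hfi.integrableAtFilter atTop)
    (fun s hs => by
      obtain ⟨b, hb⟩ := mem_atTop_sets.1 hs
      exact top_le_iff.1 ((Real.volume_Ici (a := b)).symm.le.trans (measure_mono hb))) htop
  have hzero_bot := IntegrableAtFilter.eq_zero_of_tendsto (hfi.integrableAtFilter atBot)
    (fun s hs => by
      obtain ⟨b, hb⟩ := mem_atBot_sets.1 hs
      exact top_le_iff.1 ((Real.volume_Iic (a := b)).symm.le.trans (measure_mono hb))) hbot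
  rw [← intervalIntegral.integral_Iic_add_Ioi hm.integrableOn hm.integrableOn,
    ← sub_eq_zero.1 hzero_bot, hzero_top]

lemma exists_hasCompactSupport_primitive {h : ℝ → ℝ} (hh : ContDiff ℝ ∞ h)
    (hs : HasCompactSupport h) (h0 : ∫ x, h x = 0) :
    ∃ φ : ℝ → ℝ, ContDiff ℝ ∞ φ ∧ HasCompactSupport φ ∧ deriv φ = h := by
  obtain ⟨R, hR⟩ := hs.isCompact.isBounded.subset_closedBall 0
  rw [Real.closedBall_eq_Icc, zero_sub, zero_add] at hR
  have hzero (x : ℝ) (hx : x ∉ Set.Icc (-R) R) : h x = 0 :=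
    image_eq_zero_of_notMem_tsupport (mt (@hR x) hx)
  have hderiv (x : ℝ) : HasDerivAt (fun x => ∫ t in (-R - 1)..x, h t) (h x) x :=
    intervalIntegral.integral_hasDerivAt_right (hh.continuous.intervalIntegrable _ _)
      (hh.continuous.stronglyMeasurableAtFilter _ _) hh.continuous.continuousAt
  have hderiv_eq : deriv (fun x => ∫ t in (-R - 1)..x, h t) = h := funext fun x => (hderiv x).deriv
  refine ⟨fun x => ∫ t in (-R - 1)..x, h t, ?_, ?_, hderiv_eq⟩
  · rw [contDiff_infty_iff_deriv, hderiv_eq]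
    exact ⟨fun x => (hderiv x).differentiableAt, hh⟩
  · refine HasCompactSupport.intro (isCompact_Icc (a := -R - 1) (b := |R| + 1)) fun x hx => ?_
    rw [Set.mem_Icc, not_and_or, not_le, not_le] at hx
    rcases hx with hx | hx
    · rw [intervalIntegral.integral_symm, neg_eq_zero]
      refine (intervalIntegral.integral_congr fun t ht => ?_).trans
        intervalIntegral.integral_zero
      rw [Set.uIcc_of_le hx.le] at ht
      exact hzero t fun ht' => by linarith [ht'.1, ht.2]
    · rw [← h0]
      refine intervalIntegral.integral_eq_integral_of_support_subset fun t ht => ?_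
      have := not_imp_comm.1 (hzero t) ht
      exact ⟨by linarith [this.1], by linarith [this.2, le_abs_self R]⟩

/-- The du Bois-Reymond lemma. -/
lemma exists_ae_eq_const_of_integral_deriv_smul {r : ℝ → E} (hr : LocallyIntegrable r)
    (h : ∀ φ : ℝ → ℝ, ContDiff ℝ ∞ φ → HasCompactSupport φ → ∫ x, deriv φ x • r x = 0) :
    ∃ C, r =ᵐ[volume] fun _ => C := by
  have := FiniteDimensional.complete ℝ E
  let ρ : ContDiffBump (0 : ℝ) := ⟨1, 2, one_pos, one_lt_two⟩
  have hρ : ContDiff ℝ ∞ (ρ.normed volume) := ρ.contDiff_normed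
  have hρs : HasCompactSupport (ρ.normed volume) := ρ.hasCompactSupport_normed
  let C := ∫ x, ρ.normed volume x • r x
  have hzero : ∀ᵐ x, r x - C = 0 := by
    refine ae_eq_zero_of_integral_contDiff_smul_eq_zero (hr.sub (locallyIntegrable_const C))
      fun η hη hηs => ?_
    have iη : Integrable η := hη.continuous.integrable_of_hasCompactSupport hηs
    have iρ : Integrable (ρ.normed volume) := hρ.continuous.integrable_of_hasCompactSupport hρs
    have iηr := hr.integrable_smul_left_of_hasCompactSupport hη.continuous hηs
    have iρr := hr.integrable_smul_left_of_hasCompactSupport hρ.continuous hρs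
    have iρr' : Integrable (fun x => (∫ y, η y) • ρ.normed volume x • r x) := iρr.smul _
    obtain ⟨φ, hφ, hφs, hφd⟩ := exists_hasCompactSupport_primitive
      (h := fun x => η x - (∫ y, η y) * ρ.normed volume x) (hη.sub (contDiff_const.mul hρ))
      (hηs.sub hρs.mul_left) (by
        rw [integral_sub iη (iρ.const_mul _), integral_const_mul, ρ.integral_normed, mul_one,
          sub_self])
    have hφr := h φ hφ hφs
    simp only [hφd, sub_smul, mul_smul] at hφr
    rw [integral_sub iηr iρr', integral_smul] at hφr
    simp only [smul_sub]
    rwa [integral_sub iηr (iη.smul_const C), integral_smul_const]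
  exact ⟨C, hzero.mono fun x hx => sub_eq_zero.1 hx⟩

lemma exists_hasACDeriv_of_weak {k m : ℝ → E} (hk : LocallyIntegrable k)
    (hm : ∀ a b, IntervalIntegrable m volume a b)
    (hw : ∀ φ : ℝ → ℝ, ContDiff ℝ ∞ φ → HasCompactSupport φ →
      ∫ x, (φ x • m x + deriv φ x • k x) = 0) :
    ∃ K : ℝ → E, HasACDeriv K m ∧ k =ᵐ[volume] K := by
  have := FiniteDimensional.complete ℝ E
  let P (x : ℝ) : E := ∫ t in (0 : ℝ)..x, m t
  have hP : HasACDeriv P m := .integral hm 0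
  have hPl : LocallyIntegrable P := hP.continuous.locallyIntegrable
  obtain ⟨C, hC⟩ := exists_ae_eq_const_of_integral_deriv_smul (r := fun x => k x - P x)
    (hk.sub hPl) fun φ hφ hφs => by
      have hφ1 : ContDiff ℝ 1 φ := hφ.of_le (by exact_mod_cast le_top)
      have hφ' : Continuous (deriv φ) := hφ1.continuous_deriv le_rfl
      have iφm := (locallyIntegrable_of_intervalIntegrable
        hm).integrable_smul_left_of_hasCompactSupport hφ.continuous hφs
      have iφ'k := hk.integrable_smul_left_of_hasCompactSupport hφ' hφs.deriv
      have iφ'P := hPl.integrable_smul_left_of_hasCompactSupport hφ' hφs.deriv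
      have hparts : ∫ x, (φ x • m x + deriv φ x • P x) = 0 :=
        ((HasACDeriv.of_contDiff hφ1).smul hP).integral_eq_zero
          (hPl.integrable_smul_left_of_hasCompactSupport hφ.continuous hφs) (iφm.add iφ'P)
      have hk0 := hw φ hφ hφs
      rw [integral_add iφm iφ'P] at hparts
      rw [integral_add iφm iφ'k] at hk0
      simp only [smul_sub]
      rw [integral_sub iφ'k iφ'P, sub_eq_zero]
      exact add_left_cancel (hk0.trans hparts.symm)
  refine ⟨fun x => C + P x, ((HasACDeriv.const C).add hP).congr (fun _ => rfl)
    fun x => zero_add _, ?_⟩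
  filter_upwards [hC] with x hx
  exact sub_eq_iff_eq_add.1 hx

end WeakDerivative

/-! ### Self-adjoint linear relations -/

section SelfAdjoint

variable {H : Type*} [NormedAddCommGroup H] [InnerProductSpace ℂ H]
  {G : Submodule ℂ (H × H)} {z : ℂ}

lemma isClosed_adjoint (G : Submodule ℂ (H × H)) : IsClosed (G.adjoint : Set (H × H)) := by
  have h : (G.adjoint : Set (H × H))
      = ⋂ r ∈ G, {q : H × H | inner ℂ r.2 q.1 = inner ℂ r.1 q.2} := by
    ext q
    simp [Submodule.mem_adjoint_iff, sub_eq_zero]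
  rw [h]
  exact isClosed_biInter fun r _ => isClosed_eq (by fun_prop) (by fun_prop)

lemma inner_snd_fst_eq_of_le_adjoint (hG : G ≤ G.adjoint) {q r : H × H} (hq : q ∈ G)
    (hr : r ∈ G) : inner ℂ q.2 r.1 = inner ℂ q.1 r.2 :=
  sub_eq_zero.1 ((G.mem_adjoint_iff r).1 (hG hr) q.1 q.2 hq)

lemma abs_im_mul_norm_le_of_le_adjoint (hG : G ≤ G.adjoint) {q : H × H} (hq : q ∈ G) (z : ℂ) :
    |z.im| * ‖q.1‖ ≤ ‖q.2 - z • q.1‖ := by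
  have hsymm := inner_snd_fst_eq_of_le_adjoint hG hq hq
  have hreal : (inner ℂ q.1 q.2).im = 0 := by
    rw [← Complex.conj_eq_iff_im, ← hsymm]
    exact (inner_conj_symm q.1 q.2).trans hsymm.symm
  have him : (inner ℂ q.1 (q.2 - z • q.1)).im = -(z.im * ‖q.1‖ ^ 2) := by
    rw [inner_sub_right, inner_smul_right, inner_self_eq_norm_sq_to_K, Complex.sub_im, hreal,
      RCLike.ofReal_eq_complex_ofReal, ← Complex.ofReal_pow, Complex.im_mul_ofReal, zero_sub]
  have hle : ‖q.1‖ * (|z.im| * ‖q.1‖) ≤ ‖q.1‖ * ‖q.2 - z • q.1‖ := by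
    calc ‖q.1‖ * (|z.im| * ‖q.1‖) = |(inner ℂ q.1 (q.2 - z • q.1)).im| := by
          rw [him, abs_neg, abs_mul, abs_of_nonneg (sq_nonneg ‖q.1‖)]
          ring
      _ ≤ ‖inner ℂ q.1 (q.2 - z • q.1)‖ := Complex.abs_im_le_norm _
      _ ≤ ‖q.1‖ * ‖q.2 - z • q.1‖ := norm_inner_le_norm _ _
  rcases (norm_nonneg q.1).eq_or_lt with h0 | h0
  · rw [← h0, mul_zero]
    exact norm_nonneg _
  · exact le_of_mul_le_mul_left hle h0

/-- The map `(f, g) ↦ g - z f` on a linear relation `G`; on the graph of an operator `A` it is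
`A - z`. -/
noncomputable def shiftMap (G : Submodule ℂ (H × H)) (z : ℂ) : G →L[ℂ] H :=
  (ContinuousLinearMap.snd ℂ H H - z • ContinuousLinearMap.fst ℂ H H).comp G.subtypeL

lemma shiftMap_apply (q : G) : shiftMap G z q = q.1.2 - z • q.1.1 := rfl

lemma norm_fst_le_of_le_adjoint (hG : G ≤ G.adjoint) (hz : z.im ≠ 0) (q : G) :
    ‖q.1.1‖ ≤ |z.im|⁻¹ * ‖shiftMap G z q‖ := by
  rw [inv_mul_eq_div, le_div_iff₀' (abs_pos.2 hz)]
  exact abs_im_mul_norm_le_of_le_adjoint hG q.2 z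

lemma exists_antilipschitzWith_shiftMap (hG : G ≤ G.adjoint) (hz : z.im ≠ 0) :
    ∃ K, AntilipschitzWith K (shiftMap G z) := by
  refine ⟨⟨|z.im|⁻¹ + (1 + ‖z‖ * |z.im|⁻¹), by positivity⟩,
    ContinuousLinearMap.antilipschitz_of_bound _ fun q => ?_⟩
  have hfst := norm_fst_le_of_le_adjoint hG hz q
  have hsnd : ‖q.1.2‖ ≤ ‖shiftMap G z q‖ + ‖z‖ * (|z.im|⁻¹ * ‖shiftMap G z q‖) := calc
    ‖q.1.2‖ = ‖shiftMap G z q + z • q.1.1‖ := by rw [shiftMap_apply, sub_add_cancel]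
    _ ≤ ‖shiftMap G z q‖ + ‖z‖ * ‖q.1.1‖ := (norm_add_le _ _).trans_eq (by rw [norm_smul])
    _ ≤ _ := by gcongr
  have h0 : 0 ≤ |z.im|⁻¹ * ‖shiftMap G z q‖ := by positivity
  have hz0 : 0 ≤ ‖z‖ * (|z.im|⁻¹ * ‖shiftMap G z q‖) := by positivity
  have hw := norm_nonneg (shiftMap G z q)
  change max ‖q.1.1‖ ‖q.1.2‖ ≤ (|z.im|⁻¹ + (1 + ‖z‖ * |z.im|⁻¹)) * ‖shiftMap G z q‖
  refine max_le ?_ ?_ <;> linarith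

lemma orthogonal_range_shiftMap (hG : G.adjoint = G) (hz : z.im ≠ 0) :
    (shiftMap G z).rangeᗮ = ⊥ := by
  refine (Submodule.eq_bot_iff _).2 fun h hh => ?_
  have hmem : (h, starRingEnd ℂ z • h) ∈ G := by
    rw [← hG, Submodule.mem_adjoint_iff]
    intro a b hab
    have horth := (Submodule.mem_orthogonal _ _).1 hh _ ⟨⟨(a, b), hab⟩, rfl⟩
    change inner ℂ (b - z • a) h = 0 at horth
    rwa [inner_sub_left, inner_smul_left, ← inner_smul_right] at horth
  have hle := abs_im_mul_norm_le_of_le_adjoint hG.ge hmem (starRingEnd ℂ z)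
  simp only [sub_self, norm_zero] at hle
  have him : 0 < |(starRingEnd ℂ z).im| := by simpa using hz
  exact norm_le_zero_iff.1 (nonpos_of_mul_nonpos_right hle him)

variable [CompleteSpace H]

lemma bijective_shiftMap (hG : G.adjoint = G) (hz : z.im ≠ 0) :
    Function.Bijective (shiftMap G z) := by
  obtain ⟨K, hK⟩ := exists_antilipschitzWith_shiftMap hG.ge hz
  have : CompleteSpace G := (hG ▸ isClosed_adjoint G : IsClosed (G : Set (H × H))).completeSpace_coe
  have hcl : IsClosed ((shiftMap G z).range : Set H) :=
    hK.isClosed_range (shiftMap G z).uniformContinuous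
  refine ⟨hK.injective, LinearMap.range_eq_top.1 ?_⟩
  rw [← hcl.submodule_topologicalClosure_eq]
  exact Submodule.topologicalClosure_eq_top_iff.2 (orthogonal_range_shiftMap hG hz)

lemma isResolventPoint_of_im_ne_zero {A : H →ₗ.[ℂ] H} (hA : A.graph.adjoint = A.graph)
    (hz : z.im ≠ 0) : IsResolventPoint A z := by
  let e := LinearEquiv.ofBijective (shiftMap A.graph z).toLinearMap (bijective_shiftMap hA hz)
  have he (g : H) : shiftMap A.graph z (e.symm g) = g := e.apply_symm_apply g
  let R : H →L[ℂ] H :=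
    (LinearMap.fst ℂ H H ∘ₗ A.graph.subtype ∘ₗ e.symm.toLinearMap).mkContinuous |z.im|⁻¹
      fun g => (norm_fst_le_of_le_adjoint hA.ge hz (e.symm g)).trans_eq (by rw [he])
  have hR (g : H) : R g = (e.symm g).1.1 := rfl
  refine ⟨R, fun g => ?_, fun f => ?_⟩
  · obtain ⟨f, hf₁, hf₂⟩ := A.mem_graph_iff.1 (e.symm g).2
    have hRg : R g = f := (hR g).trans hf₁.symm
    refine ⟨hRg ▸ f.2, ?_⟩
    have hf : (⟨R g, hRg ▸ f.2⟩ : A.domain) = f := Subtype.ext hRg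
    rw [hf, hf₂, hR, ← shiftMap_apply, he]
  · have h : e ⟨_, A.mem_graph f⟩ = A f - z • (f : H) := rfl
    rw [← h, hR, e.symm_apply_apply]

end SelfAdjoint

/-! ### The graph of the operator -/

section Symmetric

variable {v : Fin 2 → ℝ → ℂ}

lemma inner_expr_sub_inner_expr (x : ℝ) (e q w p : C3) :
    inner ℂ e (expr v x w p) - inner ℂ (expr v x e q) w
      = Complex.I * (form e p + form q w) := by
  simp only [PiLp.inner_apply, Fin.sum_univ_three, RCLike.inner_apply, expr_apply_zero,
    expr_apply_one, expr_apply_two, form, map_add, map_mul, map_neg, Complex.conj_I,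
    Complex.star_def, Complex.conj_conj]
  ring

lemma inner_sub_inner_expr_smul (x a b : ℝ) (e w g : C3) :
    inner ℂ (a • e) g - inner ℂ (expr v x (a • e) (b • e)) w
      = Complex.I * form e (a • slope v x w g + b • w) := by
  have h := inner_expr_sub_inner_expr (v := v) x (a • e) (b • e) w (slope v x w g)
  rw [(expr_eq_iff x w _ g).2 rfl] at h
  rw [h]
  simp only [form, PiLp.add_apply, PiLp.smul_apply, Complex.real_smul, star_mul',
    Complex.star_def, Complex.conj_ofReal]
  ring

lemma inner_J_mulVec (w u : C3) : inner ℂ (WithLp.toLp 2 (J.mulVec w.ofLp) : C3) u = form w u := by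
  simp [form, J, PiLp.inner_apply, Fin.sum_univ_three, dotProduct]
  ring

lemma norm_J_mulVec (w : C3) : ‖(WithLp.toLp 2 (J.mulVec w.ofLp) : C3)‖ = ‖w‖ := by
  simp [EuclideanSpace.norm_eq, J, Fin.sum_univ_three, dotProduct]

lemma expr_zero_left (x : ℝ) (p : C3) :
    expr v x 0 p = Complex.I • (WithLp.toLp 2 (J.mulVec p.ofLp) : C3) := by
  simp [expr]

lemma norm_expr_zero_left (x : ℝ) (p : C3) : ‖expr v x 0 p‖ = ‖p‖ := by
  rw [expr_zero_left, norm_smul, Complex.norm_I, one_mul, norm_J_mulVec]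

lemma norm_form_le (w u : C3) : ‖form w u‖ ≤ ‖w‖ * ‖u‖ := by
  rw [← inner_J_mulVec, ← norm_J_mulVec w]
  exact norm_inner_le_norm _ _

lemma integral_eq_zero_of_forall_integral_form_eq_zero {f : ℝ → C3} (hf : Integrable f)
    (h : ∀ e, ∫ x, form e (f x) = 0) : ∫ x, f x = 0 := by
  refine eq_zero_of_forall_form_eq_zero fun e => ?_
  simp only [← inner_J_mulVec] at h ⊢
  rw [← integral_inner hf, h]

lemma mem_graph_of_solves {u g : ℝ → C3} (hu : Solves v u g) (hu2 : MemLp u 2 volume)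
    (hg2 : MemLp g 2 volume) : (hu2.toLp, hg2.toLp) ∈ graph v :=
  ⟨u, hu2.coeFn_toLp, hu.congr hg2.coeFn_toLp.symm⟩

lemma inner_eq_inner_of_mem_graph {q r : L2 × L2} (hq : q ∈ graph v) (hr : r ∈ graph v) :
    inner ℂ q.2 r.1 = inner ℂ q.1 r.2 := by
  obtain ⟨w, hqw, hw⟩ := hq
  obtain ⟨u, hru, hu⟩ := hr
  have hw2 : MemLp w 2 volume := (memLp_congr_ae hqw).1 (Lp.memLp q.1)
  have hu2 : MemLp u 2 volume := (memLp_congr_ae hru).1 (Lp.memLp r.1)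
  have hae₁ : (fun x => inner ℂ (q.2 x) (r.1 x)) =ᵐ[volume] fun x => inner ℂ (q.2 x) (u x) := by
    filter_upwards [hru] with x hx using by rw [hx]
  have hae₂ : (fun x => inner ℂ (q.1 x) (r.2 x)) =ᵐ[volume] fun x => inner ℂ (w x) (r.2 x) := by
    filter_upwards [hqw] with x hx using by rw [hx]
  have i₁ := (L2.integrable_inner (𝕜 := ℂ) q.2 r.1).congr hae₁
  have i₂ := (L2.integrable_inner (𝕜 := ℂ) q.1 r.2).congr hae₂
  have hform := hasACDeriv_form hw hu
  have hform_int : Integrable fun x => form (w x) (u x) :=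
    (hw2.norm.integrable_mul hu2.norm).mono' hform.continuous.aestronglyMeasurable
      (ae_of_all _ fun x => norm_form_le _ _)
  have h := hform.integral_eq_zero hform_int ((i₁.sub i₂).const_mul _)
  rw [integral_const_mul, mul_eq_zero_iff_left Complex.I_ne_zero, integral_sub i₁ i₂,
    sub_eq_zero] at h
  rw [L2.inner_def, L2.inner_def, integral_congr_ae hae₁, integral_congr_ae hae₂, h]

end Symmetric

section Closed

open scoped ContDiff

variable {v : Fin 2 → ℝ → ℂ} {φ : ℝ → ℝ}

lemma memLp_two_smul_of_hasCompactSupport {E : Type*} [NormedAddCommGroup E] [NormedSpace ℝ E]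
    {f : ℝ → E} (hf : AEStronglyMeasurable f volume)
    (hf2 : ∀ a b, IntervalIntegrable (fun x => ‖f x‖ ^ 2) volume a b)
    (hφ : Continuous φ) (hφs : HasCompactSupport φ) : MemLp (fun x => φ x • f x) 2 volume := by
  have hm : AEStronglyMeasurable (fun x => φ x • f x) volume := hφ.aestronglyMeasurable.smul hf
  rw [memLp_two_iff_integrable_sq_norm hm]
  simp only [norm_smul, mul_pow, Real.norm_eq_abs, sq_abs]
  exact (locallyIntegrable_of_intervalIntegrable hf2).integrable_smul_left_of_hasCompactSupport
    (g := fun x => φ x ^ 2) (hφ.pow 2) (hφs.comp_left (g := (· ^ 2)) (zero_pow two_ne_zero))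

lemma memLp_expr_smul (hv : IsPotential v) (hφ : ContDiff ℝ 1 φ) (hφs : HasCompactSupport φ)
    (e : C3) : MemLp (fun x => expr v x (φ x • e) (deriv φ x • e)) 2 volume := by
  have hφ' (c : ℂ) : MemLp (fun x => deriv φ x • c) 2 volume :=
    (((hφ.continuous_deriv le_rfl).smul continuous_const).memLp_of_hasCompactSupport
      hφs.deriv.smul_right)
  have hφv (i : Fin 2) : MemLp (fun x => φ x • v i x) 2 volume :=
    memLp_two_smul_of_hasCompactSupport (hv.aestronglyMeasurable i)
      (hv.intervalIntegrable_norm_sq i) hφ.continuous hφs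
  refine MemLp.of_eval_piLp fun i => ?_
  fin_cases i
  · refine MemLp.ae_eq (ae_of_all _ fun x => ?_) (((hφ' (e 0)).const_mul Complex.I).add
      (((hφv 0).star.mul_const (e 1)).add ((hφv 1).star.mul_const (e 2))))
    simp [expr_apply_zero]
    ring
  · refine MemLp.ae_eq (ae_of_all _ fun x => ?_)
      (((hφ' (e 1)).const_mul Complex.I).neg.add ((hφv 0).mul_const (e 0)))
    simp [expr_apply_one]
    ring
  · refine MemLp.ae_eq (ae_of_all _ fun x => ?_)
      (((hφ' (e 2)).const_mul Complex.I).neg.add ((hφv 1).mul_const (e 0)))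
    simp [expr_apply_two]
    ring

lemma solves_smul_const (hφ : ContDiff ℝ 1 φ) (e : C3) :
    Solves v (fun x => φ x • e) (fun x => expr v x (φ x • e) (deriv φ x • e)) :=
  ⟨((HasACDeriv.of_contDiff hφ).smul (.const e)).1, ae_of_all _ fun x =>
    ⟨_, (hφ.differentiable one_ne_zero x).hasDerivAt.smul_const e, rfl⟩⟩

lemma intervalIntegrable_mul_of_memLp {h f : ℝ → ℂ} (hh : AEStronglyMeasurable h volume)
    (hh2 : ∀ a b, IntervalIntegrable (fun x => ‖h x‖ ^ 2) volume a b) (hf : MemLp f 2 volume)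
    (a b : ℝ) : IntervalIntegrable (fun x => h x * f x) volume a b :=
  intervalIntegrable_iff.2 <| MemLp.integrable_mul
    ((memLp_two_iff_integrable_sq_norm hh.restrict).2 (hh2 a b).def') (hf.restrict _)

lemma intervalIntegrable_slope (hv : IsPotential v) {f g : ℝ → C3} (hf : MemLp f 2 volume)
    (hg : MemLp g 2 volume) (a b : ℝ) :
    IntervalIntegrable (fun x => slope v x (f x) (g x)) volume a b := by
  have hgi (i : Fin 3) : IntervalIntegrable (fun x => g x i) volume a b :=
    (((hg.eval_piLp i).locallyIntegrable one_le_two).integrableOn_isCompact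
      isCompact_uIcc).intervalIntegrable
  have hvf (i : Fin 2) (j : Fin 3) : IntervalIntegrable (fun x => v i x * f x j) volume a b :=
    intervalIntegrable_mul_of_memLp (hv.aestronglyMeasurable i) (hv.intervalIntegrable_norm_sq i)
      (hf.eval_piLp j) a b
  have hsvf (i : Fin 2) (j : Fin 3) :
      IntervalIntegrable (fun x => star (v i x) * f x j) volume a b :=
    intervalIntegrable_mul_of_memLp (hv.aestronglyMeasurable i).star
      (by simpa only [Pi.star_apply, norm_star] using hv.intervalIntegrable_norm_sq i)
      (hf.eval_piLp j) a b
  rw [intervalIntegrable_iff]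
  refine Integrable.of_eval_piLp fun i => ?_
  rw [← IntegrableOn, ← intervalIntegrable_iff]
  fin_cases i
  exacts [(((hgi 0).sub (hsvf 0 1)).sub (hsvf 1 2)).const_mul _,
    ((hgi 1).sub (hvf 0 0)).const_mul _, ((hgi 2).sub (hvf 1 0)).const_mul _]

lemma integral_inner_sub_inner_expr_smul_eq_zero (hv : IsPotential v) {q : L2 × L2}
    (hq : ∀ r ∈ graph v, inner ℂ r.2 q.1 = inner ℂ r.1 q.2) (hφ : ContDiff ℝ 1 φ)
    (hφs : HasCompactSupport φ) (e : C3) :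
    ∫ x, (inner ℂ (φ x • e) (q.2 x)
      - inner ℂ (expr v x (φ x • e) (deriv φ x • e)) (q.1 x)) = 0 := by
  have hφe : MemLp (fun x => φ x • e) 2 volume :=
    (hφ.continuous.smul continuous_const).memLp_of_hasCompactSupport hφs.smul_right
  have hexpr := memLp_expr_smul hv hφ hφs e
  have h := hq _ (mem_graph_of_solves (solves_smul_const hφ e) hφe hexpr)
  rw [L2.inner_def, L2.inner_def, eq_comm, ← sub_eq_zero,
    ← integral_sub (L2.integrable_inner _ _) (L2.integrable_inner _ _)] at h
  rw [← h]
  refine integral_congr_ae ?_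
  filter_upwards [hφe.coeFn_toLp, hexpr.coeFn_toLp] with x h₁ h₂
  rw [h₁, h₂]

lemma mem_graph_of_forall_inner_eq (hv : IsPotential v) {q : L2 × L2}
    (hq : ∀ r ∈ graph v, inner ℂ r.2 q.1 = inner ℂ r.1 q.2) : q ∈ graph v := by
  have hslope := intervalIntegrable_slope hv (Lp.memLp q.1) (Lp.memLp q.2)
  have hloc : LocallyIntegrable q.1 := (Lp.memLp q.1).locallyIntegrable one_le_two
  obtain ⟨u, hu, hqu⟩ := exists_hasACDeriv_of_weak hloc hslope fun φ hφ hφs => by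
    have hφ1 : ContDiff ℝ 1 φ := hφ.of_le (by exact_mod_cast le_top)
    refine integral_eq_zero_of_forall_integral_form_eq_zero
      (((locallyIntegrable_of_intervalIntegrable
        hslope).integrable_smul_left_of_hasCompactSupport hφ.continuous hφs).add
      (hloc.integrable_smul_left_of_hasCompactSupport (hφ1.continuous_deriv le_rfl) hφs.deriv))
      fun e => ?_
    have hzero := integral_inner_sub_inner_expr_smul_eq_zero hv hq hφ1 hφs e
    simpa only [inner_sub_inner_expr_smul, integral_const_mul, mul_eq_zero, Complex.I_ne_zero,
      false_or] using hzero
  refine ⟨u, hqu, solves_iff_hasACDeriv.2 (hu.congr_deriv ?_)⟩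
  filter_upwards [hqu] with x hx
  rw [hx]

lemma adjoint_graph (hv : IsPotential v) : (graph v).adjoint = graph v := by
  ext q
  simp only [Submodule.mem_adjoint_iff, sub_eq_zero]
  exact ⟨fun h => mem_graph_of_forall_inner_eq hv fun r hr => h r.1 r.2 hr,
    fun hq a b hab => inner_eq_inner_of_mem_graph hab hq⟩

end Closed

/-! ### Bloch solutions -/

section Bloch

variable {v : Fin 2 → ℝ → ℂ} {u : ℝ → C3} {z τ : ℂ}

lemma Solves.eq_mulVec_fundamentalSolution (hv : IsPotential v)
    (hu : Solves v u (fun x => z • u x)) (x : ℝ) :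
    (u x).ofLp = (fundamentalSolution v z x).mulVec (u 0).ofLp := by
  have hy := isFundamentalSolution_fundamentalSolution hv z
  have hzero := ((((hu.sub ((hy.2 0).const_smul (u 0 0))).sub ((hy.2 1).const_smul (u 0 1))).sub
    ((hy.2 2).const_smul (u 0 2))).congr (ae_of_all _ fun x => by
      simp only [smul_sub, smul_comm z])).eq_zero hv (z := z) (x₀ := 0) (by
      ext i
      fin_cases i <;> simp [column, hy.1]) x
  ext i
  have hi := congrArg (fun p : C3 => p i) hzero
  simp only [column, PiLp.sub_apply, PiLp.smul_apply, smul_eq_mul, PiLp.zero_apply] at hi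
  simp only [Matrix.mulVec, dotProduct, Fin.sum_univ_three]
  linear_combination hi

lemma exists_solves_comp_add_one_eq_smul (hv : IsPotential v) (hτ : D v τ z = 0) :
    ∃ u, Solves v u (fun x => z • u x) ∧ u 0 ≠ 0 ∧ ∀ x, u (x + 1) = τ • u x := by
  obtain ⟨c, hc0, hc⟩ := Matrix.exists_mulVec_eq_zero_iff.2 hτ
  rw [Matrix.sub_mulVec, Matrix.smul_mulVec, Matrix.one_mulVec, sub_eq_zero] at hc
  obtain ⟨u, hu0, hu⟩ := exists_solves hv z 0 (WithLp.toLp 2 c)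
  have hdiff : Solves v (fun x => u (x + 1) - τ • u x) (fun x => z • (u (x + 1) - τ • u x)) := by
    simpa only [smul_sub, smul_comm τ] using (hu.comp_add_one hv).sub (hu.const_smul τ)
  have hinit : u (0 + 1) - τ • u 0 = 0 := by
    refine sub_eq_zero.2 (WithLp.ofLp_injective 2 ?_)
    rw [zero_add, hu.eq_mulVec_fundamentalSolution hv, hu0]
    exact hc
  exact ⟨u, hu, fun h => hc0 ((WithLp.toLp_eq_zero 2).1 (hu0.symm.trans h)),
    fun x => sub_eq_zero.1 (hdiff.eq_zero hv hinit x)⟩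

lemma exists_multiplier_norm_eq_one (hv : IsPotential v) (t : ℝ) :
    ∃ τ : ℂ, ‖τ‖ = 1 ∧ D v τ t = 0 := by
  classical
  obtain ⟨τ, hτ, hnorm⟩ : ∃ τ ∈ multipliers v t, ‖τ‖ = 1 := by
    rw [← Multiset.countP_pos]
    rcases countP_multipliers hv t with h | h <;> simp [h]
  refine ⟨τ, hnorm, ?_⟩
  simpa [eval_charpoly_monodromy] using (Polynomial.mem_roots'.1 hτ).2

lemma exists_solves_norm_periodic (hv : IsPotential v) (t : ℝ) :
    ∃ u, Solves v u (fun x => (t : ℂ) • u x) ∧ u 0 ≠ 0 ∧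
      Function.Periodic (fun x => ‖u x‖) 1 := by
  obtain ⟨τ, hnorm, hτ⟩ := exists_multiplier_norm_eq_one hv t
  obtain ⟨u, hu, hu0, hshift⟩ := exists_solves_comp_add_one_eq_smul hv hτ
  exact ⟨u, hu, hu0, fun x => by simp only [hshift, norm_smul, hnorm, one_mul]⟩

end Bloch

/-! ### Weyl sequences -/

section Weyl

variable {v : Fin 2 → ℝ → ℂ} {u g : ℝ → C3} {φ : ℝ → ℝ}

lemma norm_toLp_sq {α E : Type*} [MeasurableSpace α] {μ : Measure α} [NormedAddCommGroup E]
    {f : α → E} (hf : MemLp f 2 μ) : ‖hf.toLp‖ ^ 2 = ∫ x, ‖f x‖ ^ 2 ∂μ := by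
  have hnonneg : 0 ≤ ∫ x, ‖f x‖ ^ 2 ∂μ := integral_nonneg fun x => sq_nonneg _
  rw [Lp.norm_toLp, hf.eLpNorm_eq_integral_rpow_norm two_ne_zero ENNReal.ofNat_ne_top]
  simp only [ENNReal.toReal_ofNat, Real.rpow_two]
  rw [ENNReal.toReal_ofReal (by positivity), ← Real.rpow_natCast, ← Real.rpow_mul hnonneg]
  simp

lemma Solves.smul (hu : Solves v u g) (hφ : ContDiff ℝ 1 φ) :
    Solves v (fun x => φ x • u x) (fun x => φ x • g x + deriv φ x • expr v x 0 (u x)) := by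
  refine ⟨((HasACDeriv.of_contDiff hφ).smul (solves_iff_hasACDeriv.1 hu)).1, ?_⟩
  filter_upwards [hu.2] with x ⟨p, hp, he⟩
  refine ⟨_, (hφ.differentiable one_ne_zero x).hasDerivAt.smul hp, ?_⟩
  rw [← he]
  simp only [RCLike.real_smul_eq_coe_smul (K := ℂ), ← expr_smul, ← expr_add, smul_zero, add_zero]

lemma IsResolventPoint.exists_norm_le {E : Type*} [NormedAddCommGroup E] [NormedSpace ℂ E]
    {A : E →ₗ.[ℂ] E} {z : ℂ} (hz : IsResolventPoint A z) :
    ∃ C, ∀ q ∈ A.graph, ‖q.1‖ ≤ C * ‖q.2 - z • q.1‖ := by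
  obtain ⟨R, -, hR⟩ := hz
  refine ⟨‖R‖, fun q hq => ?_⟩
  obtain ⟨f, hf₁, hf₂⟩ := A.mem_graph_iff.1 hq
  calc ‖q.1‖ = ‖R (q.2 - z • q.1)‖ := by rw [← hf₁, ← hf₂, hR]
    _ ≤ ‖R‖ * ‖q.2 - z • q.1‖ := R.le_opNorm _

lemma exists_integral_norm_sq_le_of_isResolventPoint {z : ℂ}
    (hz : IsResolventPoint (operator v) z) :
    ∃ K, ∀ w h : ℝ → C3, MemLp w 2 volume → MemLp h 2 volume →
      Solves v w (fun x => z • w x + h x) → ∫ x, ‖w x‖ ^ 2 ≤ K * ∫ x, ‖h x‖ ^ 2 := by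
  obtain ⟨C, hC⟩ := hz.exists_norm_le
  rw [operator_graph] at hC
  refine ⟨C ^ 2, fun w h hw hh hsolves => ?_⟩
  have hsum := (hw.const_smul z).add hh
  have hle : ‖hw.toLp‖ ≤ C * ‖hsum.toLp - z • hw.toLp‖ :=
    hC (hw.toLp, hsum.toLp) (mem_graph_of_solves hsolves hw hsum)
  rw [MemLp.toLp_add (hw.const_smul z) hh, MemLp.toLp_const_smul z hw, add_sub_cancel_left] at hle
  rw [← norm_toLp_sq hw, ← norm_toLp_sq hh, ← mul_pow]
  exact pow_le_pow_left₀ (norm_nonneg _) hle 2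

lemma exists_integral_norm_smul_sq_le_of_isResolventPoint {z : ℂ}
    (hz : IsResolventPoint (operator v) z) (hu : Solves v u (fun x => z • u x)) :
    ∃ K, ∀ φ : ℝ → ℝ, ContDiff ℝ 1 φ → HasCompactSupport φ →
      ∫ x, ‖φ x • u x‖ ^ 2 ≤ K * ∫ x, ‖deriv φ x • u x‖ ^ 2 := by
  obtain ⟨K, hK⟩ := exists_integral_norm_sq_le_of_isResolventPoint hz
  refine ⟨K, fun φ hφ hφs => ?_⟩
  have hexpr : Continuous fun x => expr v x 0 (u x) := by
    have hc := hu.continuous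
    simp only [expr_zero_left]
    fun_prop
  have hle := hK (fun x => φ x • u x) (fun x => deriv φ x • expr v x 0 (u x))
    ((hφ.continuous.smul hu.continuous).memLp_of_hasCompactSupport hφs.smul_right)
    (((hφ.continuous_deriv le_rfl).smul hexpr).memLp_of_hasCompactSupport hφs.deriv.smul_right)
    (by simpa only [smul_comm _ z] using hu.smul hφ)
  simpa only [norm_smul, norm_expr_zero_left] using hle

lemma exists_cutoff : ∃ C, ∀ R : ℝ, 0 < R → ∃ φ : ℝ → ℝ, ContDiff ℝ 1 φ ∧
    (∀ x ∈ Set.Icc (-R) R, φ x = 1) ∧ tsupport φ ⊆ Set.Icc (-(2 * R)) (2 * R) ∧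
    ∀ x, |deriv φ x| ≤ C / R := by
  let χ : ContDiffBump (0 : ℝ) := ⟨1, 2, one_pos, one_lt_two⟩
  have hχ : ContDiff ℝ 1 χ := χ.contDiff
  obtain ⟨C, hC⟩ :=
    (hχ.continuous_deriv le_rfl).bounded_above_of_compact_support χ.hasCompactSupport.deriv
  refine ⟨C, fun R hR => ⟨fun x => χ (x / R), hχ.comp (contDiff_id.div_const R), ?_, ?_, ?_⟩⟩
  · intro x hx
    refine χ.one_of_mem_closedBall ?_
    rw [mem_closedBall_zero_iff, Real.norm_eq_abs, abs_div, abs_of_pos hR]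
    exact (div_le_one hR).2 (abs_le.2 hx)
  · refine closure_minimal (Function.support_subset_iff'.2 fun x hx => χ.zero_of_le_dist ?_)
      isClosed_Icc
    rw [dist_zero_right, Real.norm_eq_abs, abs_div, abs_of_pos hR, le_div_iff₀ hR]
    exact le_of_not_ge fun h => hx (abs_le.1 h)
  · intro x
    have hderiv : deriv (fun y => χ (y / R)) x = deriv χ (x / R) / R := by
      have h := (hχ.differentiable one_ne_zero (x / R)).hasDerivAt.comp x
        ((hasDerivAt_id x).div_const R)
      rw [← mul_one_div]
      exact h.deriv
    rw [hderiv, abs_div, abs_of_pos hR]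
    exact div_le_div_of_nonneg_right (hC _) hR.le

variable {E : Type*} [NormedAddCommGroup E] [NormedSpace ℝ E] {f : ℝ → E} {R c : ℝ}

lemma intervalIntegral_norm_sq_le_integral (hf : Continuous f) (hφ : Continuous φ)
    (hφs : HasCompactSupport φ) (hR : 0 ≤ R) (hone : ∀ x ∈ Set.Icc (-R) R, φ x = 1) :
    ∫ x in (-R)..R, ‖f x‖ ^ 2 ≤ ∫ x, ‖φ x • f x‖ ^ 2 := by
  have hmem : MemLp (fun x => φ x • f x) 2 volume :=
    (hφ.smul hf).memLp_of_hasCompactSupport hφs.smul_right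
  rw [intervalIntegral.integral_of_le (by linarith)]
  calc ∫ x in Set.Ioc (-R) R, ‖f x‖ ^ 2 = ∫ x in Set.Ioc (-R) R, ‖φ x • f x‖ ^ 2 :=
        setIntegral_congr_fun measurableSet_Ioc fun x hx => by
          simp only [hone x (Set.Ioc_subset_Icc_self hx), one_smul]
    _ ≤ _ := setIntegral_le_integral
        ((memLp_two_iff_integrable_sq_norm hmem.1).1 hmem) (ae_of_all _ fun x => sq_nonneg _)

lemma integral_norm_smul_sq_le (hf : Continuous f) (hφ : Continuous φ) (hR : 0 ≤ R)
    (hsupp : Function.support φ ⊆ Set.Icc (-R) R) (hc : ∀ x, |φ x| ≤ c) :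
    ∫ x, ‖φ x • f x‖ ^ 2 ≤ c ^ 2 * ∫ x in (-R)..R, ‖f x‖ ^ 2 := by
  rw [intervalIntegral.integral_of_le (by linarith), ← integral_Icc_eq_integral_Ioc,
    ← integral_const_mul, ← setIntegral_eq_integral_of_forall_compl_eq_zero
      (s := Set.Icc (-R) R) fun x hx => by
        simp [Function.support_subset_iff'.1 hsupp x hx]]
  refine setIntegral_mono_on ((hφ.smul hf).norm.pow 2).continuousOn.integrableOn_Icc
    (continuous_const.mul (hf.norm.pow 2)).continuousOn.integrableOn_Icc measurableSet_Icc
    fun x _ => ?_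
  rw [norm_smul, mul_pow]
  gcongr
  exact hc x

lemma intervalIntegral_neg_self_of_periodic {h : ℝ → ℝ} (hh : Function.Periodic h 1)
    (hc : Continuous h) (n : ℕ) :
    ∫ x in (-n : ℝ)..n, h x = 2 * n * ∫ x in (0 : ℝ)..1, h x := by
  have hsum := hh.intervalIntegral_add_zsmul_eq (2 * n : ℤ) (-n)
    fun a b => hc.intervalIntegrable a b
  have hend : (-n : ℝ) + (2 * n : ℤ) • (1 : ℝ) = n := by
    push_cast [zsmul_eq_mul]
    ring
  rw [hend, hh.intervalIntegral_add_eq (-n : ℝ) 0, zero_add] at hsum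
  simpa using hsum

lemma exists_cutoff_of_periodic_norm (hf : Continuous f)
    (hper : Function.Periodic (fun x => ‖f x‖) 1) :
    ∃ C, ∀ n : ℕ, 0 < n → ∃ φ : ℝ → ℝ, ContDiff ℝ 1 φ ∧ HasCompactSupport φ ∧
      n * ∫ x in (0 : ℝ)..1, ‖f x‖ ^ 2 ≤ ∫ x, ‖φ x • f x‖ ^ 2 ∧
      ∫ x, ‖deriv φ x • f x‖ ^ 2 ≤ C / n * ∫ x in (0 : ℝ)..1, ‖f x‖ ^ 2 := by
  obtain ⟨C, hcutoff⟩ := exists_cutoff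
  have hgrowth (n : ℕ) : ∫ x in (-n : ℝ)..n, ‖f x‖ ^ 2
      = 2 * n * ∫ x in (0 : ℝ)..1, ‖f x‖ ^ 2 :=
    intervalIntegral_neg_self_of_periodic (fun x => congrArg (· ^ 2) (hper x)) (hf.norm.pow 2) n
  refine ⟨4 * C ^ 2, fun n hn => ?_⟩
  have hn0 : (0 : ℝ) < n := by exact_mod_cast hn
  obtain ⟨φ, hφ, hone, hsupp, hderiv⟩ := hcutoff n hn0
  have hφs : HasCompactSupport φ := isCompact_Icc.of_isClosed_subset (isClosed_tsupport φ) hsupp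
  have hA : 0 ≤ ∫ x in (0 : ℝ)..1, ‖f x‖ ^ 2 :=
    intervalIntegral.integral_nonneg zero_le_one fun x _ => sq_nonneg _
  refine ⟨φ, hφ, hφs, ?_, ?_⟩
  · calc n * ∫ x in (0 : ℝ)..1, ‖f x‖ ^ 2 ≤ 2 * n * ∫ x in (0 : ℝ)..1, ‖f x‖ ^ 2 := by
          gcongr
          linarith
      _ = ∫ x in (-n : ℝ)..n, ‖f x‖ ^ 2 := (hgrowth n).symm
      _ ≤ _ := intervalIntegral_norm_sq_le_integral hf hφ.continuous hφs hn0.le hone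
  · calc ∫ x, ‖deriv φ x • f x‖ ^ 2
        ≤ (C / n) ^ 2 * ∫ x in (-(2 * n : ℕ) : ℝ)..(2 * n : ℕ), ‖f x‖ ^ 2 :=
          integral_norm_smul_sq_le hf (hφ.continuous_deriv le_rfl) (Nat.cast_nonneg _)
            (by simpa using support_deriv_subset.trans hsupp) hderiv
      _ = _ := by
          rw [hgrowth]
          push_cast
          field_simp
          ring

theorem not_exists_integral_norm_smul_sq_le (hf : Continuous f) (h0 : f 0 ≠ 0)
    (hper : Function.Periodic (fun x => ‖f x‖) 1) :
    ¬ ∃ K, ∀ φ : ℝ → ℝ, ContDiff ℝ 1 φ → HasCompactSupport φ →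
      ∫ x, ‖φ x • f x‖ ^ 2 ≤ K * ∫ x, ‖deriv φ x • f x‖ ^ 2 := by
  rintro ⟨K, hK⟩
  obtain ⟨C, hcutoff⟩ := exists_cutoff_of_periodic_norm hf hper
  have hA : 0 < ∫ x in (0 : ℝ)..1, ‖f x‖ ^ 2 :=
    intervalIntegral.integral_pos zero_lt_one (hf.norm.pow 2).continuousOn
      (fun x _ => sq_nonneg _) ⟨0, by simp, by positivity⟩
  have hsq (n : ℕ) (hn : 0 < n) : (n : ℝ) ^ 2 ≤ |K| * C := by
    obtain ⟨φ, hφ, hφs, hlower, hupper⟩ := hcutoff n hn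
    have hle : n * ∫ x in (0 : ℝ)..1, ‖f x‖ ^ 2
        ≤ |K| * C / n * ∫ x in (0 : ℝ)..1, ‖f x‖ ^ 2 := calc
      _ ≤ K * ∫ x, ‖deriv φ x • f x‖ ^ 2 := hlower.trans (hK φ hφ hφs)
      _ ≤ |K| * (C / n * ∫ x in (0 : ℝ)..1, ‖f x‖ ^ 2) := by
        gcongr
        exact le_abs_self K
      _ = _ := by ring
    rw [sq, ← le_div_iff₀ (by positivity)]
    exact le_of_mul_le_mul_right hle hA
  have hlim : Tendsto (fun n : ℕ => (n : ℝ) ^ 2) atTop atTop :=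
    (tendsto_pow_atTop two_ne_zero).comp tendsto_natCast_atTop_atTop
  obtain ⟨n, hn, hn0⟩ :=
    ((hlim.eventually_gt_atTop (|K| * C)).and (eventually_gt_atTop 0)).exists
  exact hn.not_ge (hsq n hn0)

theorem not_isResolventPoint_operator_ofReal (hv : IsPotential v) (t : ℝ) :
    ¬ IsResolventPoint (operator v) t := by
  intro ht
  obtain ⟨u, hu, hu0, hper⟩ := exists_solves_norm_periodic hv t
  exact not_exists_integral_norm_smul_sq_le hu.continuous hu0 hper
    (exists_integral_norm_smul_sq_le_of_isResolventPoint ht hu)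

theorem spectrumOf_operator (hv : IsPotential v) :
    spectrumOf (operator v) = Set.range (fun t : ℝ => (t : ℂ)) := by
  ext z
  refine ⟨fun hz => ⟨z.re, Complex.ext rfl ?_⟩, ?_⟩
  · by_contra him
    refine hz (isResolventPoint_of_im_ne_zero ?_ fun h => him h.symm)
    rw [operator_graph, adjoint_graph hv]
  · rintro ⟨t, rfl⟩
    exact not_isResolventPoint_operator_ofReal hv t

end Weyl

end Manakov

theorem theorem1p1_general (v : Fin 2 → ℝ → ℂ) (hv : Manakov.IsPotential v) :
    (∀ z : ℂ, ∃! y, Manakov.IsFundamentalSolution v z y) ∧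
    (∃ τ : Fin 3 → ℂ → ℂ,
      (∀ z : ℂ, Manakov.multipliers v z = {τ 0 z, τ 1 z, τ 2 z}) ∧
      ∀ j : Fin 3, τ j ~[Bornology.cobounded ℂ] Manakov.freeMultiplier j) ∧
    (∀ τ z : ℂ, Manakov.D v τ z =
      -τ ^ 3 + τ ^ 2 * Manakov.T v z
        - τ * Complex.exp (Complex.I * z) * Manakov.Ttilde v z + Complex.exp (Complex.I * z)) ∧
    (∀ z : ℂ, (Manakov.monodromy v z).det = Complex.exp (Complex.I * z)) ∧
    (∀ z τ₁ τ₂ τ₃ : ℂ, Manakov.multipliers v z = {τ₁, τ₂, τ₃} →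
      Complex.exp (Complex.I * z) = τ₁ * τ₂ * τ₃ ∧
      Manakov.Ttilde v z = 1 / τ₁ + 1 / τ₂ + 1 / τ₃ ∧
      Manakov.Ttilde v z =
        Complex.exp (-Complex.I * z) * (τ₁ * τ₂ + τ₂ * τ₃ + τ₃ * τ₁)) ∧
    Manakov.spectrumOf (Manakov.operator v) = Set.range (fun t : ℝ => (t : ℂ)) ∧
    Manakov.spectralPart v 1 ∪ Manakov.spectralPart v 3 = Set.univ ∧
    Manakov.spectralPart v 2 = ∅ :=
  ⟨Manakov.existsUnique_isFundamentalSolution hv, Manakov.exists_labelling_isEquivalent hv,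
    Manakov.D_eq hv, Manakov.det_monodromy hv,
    fun _ _ _ _ h => Manakov.multipliers_identities hv h, Manakov.spectrumOf_operator hv,
    Manakov.spectralPart_one_union_three hv, Manakov.spectralPart_two hv⟩

theorem theorem1p1 (v : Fin 2 → ℝ → ℂ) (hv : Manakov.IsPotential v) :
    -- the fundamental solution is well defined
    (∀ z : ℂ, ∃! y, Manakov.IsFundamentalSolution v z y) ∧
    -- asymptotics of the multipliers, suitably labelled
    (∃ τ : Fin 3 → ℂ → ℂ,
      (∀ z : ℂ, Manakov.multipliers v z = {τ 0 z, τ 1 z, τ 2 z}) ∧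
      ∀ δ : ℝ, 0 < δ → δ < 1 / 2 → ∀ j : Fin 3,
        τ j ~[Manakov.awayFilter δ] Manakov.freeMultiplier j) ∧
    -- the characteristic polynomial
    (∀ τ z : ℂ, Manakov.D v τ z =
      -τ ^ 3 + τ ^ 2 * Manakov.T v z
        - τ * Complex.exp (Complex.I * z) * Manakov.Ttilde v z + Complex.exp (Complex.I * z)) ∧
    -- the determinant and the identities for the multipliers, in any labelling
    (∀ z : ℂ, (Manakov.monodromy v z).det = Complex.exp (Complex.I * z)) ∧
    (∀ z τ₁ τ₂ τ₃ : ℂ, Manakov.multipliers v z = {τ₁, τ₂, τ₃} →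
      Complex.exp (Complex.I * z) = τ₁ * τ₂ * τ₃ ∧
      Manakov.Ttilde v z = 1 / τ₁ + 1 / τ₂ + 1 / τ₃ ∧
      Manakov.Ttilde v z =
        Complex.exp (-Complex.I * z) * (τ₁ * τ₂ + τ₂ * τ₃ + τ₃ * τ₁)) ∧
    -- the spectrum
    Manakov.spectrumOf (Manakov.operator v) = Set.range (fun t : ℝ => (t : ℂ)) ∧
    Manakov.spectralPart v 1 ∪ Manakov.spectralPart v 3 = Set.univ ∧
    Manakov.spectralPart v 2 = ∅ := by
  obtain ⟨hy, ⟨τ, hτ, hasymp⟩, h⟩ := theorem1p1_general v hv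
  exact ⟨hy, ⟨τ, hτ, fun _ _ _ j => (hasymp j).mono inf_le_left⟩, h⟩
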